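/- **Asymptotic normality for model-based LQ RL.** Fix a horizon $T$ and consider the linear system $x_{t+1}=Ax_t+Bu_t+\omega_t$ $(0\le t\le T-1)$ with $A\in\mathbb R^{d\times d}$, $B\in\mathbb R^{d\times p}$, linear policies $u_t=-K_tx_t$, $K_t\in\mathbb R^{p\times d}$, and cost $\mathbb E\big[\sum_{t=0}^{T-1}(x_t^\top Q_tx_t+u_t^\top R_tu_t)+x_T^\top Q_Tx_T\big]$. Assume: 1. $Q_0,\dots,Q_T$ and $R_0,\dots,R_{T-1}$ are (symmetric) positive definite; 2. there is a $K$ such that the spectral radius of $A+BK$ is strictly less than $1$; 3. $x_0\sim\mathcal P$, the noises $\omega_0,\dots,\omega_{T-1}$ are i.i.d. and independent of $x_0$, $x_0$ and $\omega$ have finite second moments, $\mathbb E[\omega]=0$, and $\mathbb E[x_0x_0^\top]$ and $\mathbb E[\omega\omega^\top]$ are positive definite; 4. the step sizes are $\eta_\ell=C\ell^{-\alpha}$ for $\ell\ge1$, with some $C>0$ and $\alpha\in[1/2,1)$ ($\eta_0\in\mathbb R$ is arbitrary). Let $P^\star_T=Q_T$, $P_t^\star=Q_t+A^\top P_{t+1}^\star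 A-A^\top P_{t+1}^\star B(B^\top P_{t+1}^\star B+R_t)^{-1}B^\top P_{t+1}^\star A$, and let $K_t^\star=(B^\top P_{t+1}^\star B+R_t)^{-1}B^\top P_{t+1}^\star A$ be the optimal policy. For a policy $\boldsymbol K=(K_0,\dots,K_{T-1})$ let $P_T^{\boldsymbol K}=Q_T$, $P_t^{\boldsymbol K}=Q_t+K_t^\top R_tK_t+(A-BK_t)^\top P_{t+1}^{\boldsymbol K}(A-BK_t)$, and $E_t(\boldsymbol K)=(R_t+B^\top P_{t+1}^{\boldsymbol K}B)K_t-B^\top P_{t+1}^{\boldsymbol K}A$. Fix a linear policy that generates the sampled states, and let $\mathcal P_t$ be the law of $x_t$ under it. Let $(x_0^\ell,\dots,x_T^\ell)$, $\ell=0,1,2,\dots$, be i.i.d. trajectories of the system under this policy. Starting from an arbitrary deterministic policy $\boldsymbol K^0$, define the policy-gradient iterates, simultaneously for all stages $t=0,\dots,T-1$, by $$K_t^{\ell+1}=K_t^\ell-2\eta_\ell\,E_t(\boldsymbol K^\ell)\,x_t^\ell(x_t^\ell)^\top .$$ Then for every stage $t\in\{0,\dots,T-1\}$, as $n\to\infty$,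 $$\frac1{\sqrt n}\sum_{\ell=1}^n\big(\operatorname{vec}K_t^\ell-\operatorname{vec}K_t^\star\big)\ \xrightarrow{d}\ \mathcal N\big(0,\ G_t^{-1}S_tG_t^{-1}\big),$$ where, with $x_t\sim\mathcal P_t$, $$G_t=\mathbb E[x_tx_t^\top]\otimes(R_t+B^\top P_{t+1}^\star B),\qquad S_t=\mathbb E\big[\operatorname{vec}\{E_t(\boldsymbol K^\star)x_tx_t^\top\}\operatorname{vec}\{E_t(\boldsymbol K^\star)x_tx_t^\top\}^\top\big].$$ Moreover these quantities are well defined: $x_t\sim\mathcal P_t$ and $\operatorname{vec}\{E_t(\boldsymbol K^\star)x_tx_t^\top\}$ have finite second moments, and $G_t$ is positive definite. -/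

import Mathlib

open MeasureTheory ProbabilityTheory Filter Topology
open scoped Matrix Kronecker

namespace LQRL

noncomputable section

/-- Data of a finite-horizon linear-quadratic problem: horizon `T`, state dimension `d`,
action dimension `p`, system matrices `A`, `B`, state costs `Q 0, …, Q T` and action costs
`R 0, …, R (T-1)`. -/
structure Model (d p T : ℕ) where
  A : Matrix (Fin d) (Fin d) ℝ
  B : Matrix (Fin d) (Fin p) ℝ
  Q : Fin (T + 1) → Matrix (Fin d) (Fin d) ℝ
  R : Fin T → Matrix (Fin p) (Fin p) ℝ

/-- A linear policy `K = (K 0, …, K (T-1))`; the action at stage `t` is `u t = - K t * x t`. -/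
abbrev Policy (d p T : ℕ) := Fin T → Matrix (Fin p) (Fin d) ℝ

namespace Model

variable {d p T : ℕ} (M : Model d p T)

/-- All cost matrices are (symmetric) positive definite. -/
def CostPosDef : Prop := (∀ t, (M.Q t).PosDef) ∧ ∀ t, (M.R t).PosDef

/-- The pair `(A, B)` is stabilizable: some `A + B K` has (complex) spectral radius `< 1`. -/
def Stabilizable : Prop :=
  ∃ K : Matrix (Fin p) (Fin d) ℝ,
    spectralRadius ℂ ((M.A + M.B * K).map (algebraMap ℝ ℂ)) < 1

/-- Solution of the backward Riccati equation, `riccati (Fin.last T) = Q T`. -/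
def riccati : Fin (T + 1) → Matrix (Fin d) (Fin d) ℝ :=
  Fin.reverseInduction (motive := fun _ => Matrix (Fin d) (Fin d) ℝ) (M.Q (Fin.last T))
    (fun t P => M.Q t.castSucc + M.Aᵀ * P * M.A
      - M.Aᵀ * P * M.B * (M.Bᵀ * P * M.B + M.R t)⁻¹ * M.Bᵀ * P * M.A)

/-- The optimal policy `K⋆ t = (Bᵀ P⋆ (t+1) B + R t)⁻¹ Bᵀ P⋆ (t+1) A`. -/
def optimalPolicy : Policy d p T := fun t =>
  (M.Bᵀ * M.riccati t.succ * M.B + M.R t)⁻¹ * M.Bᵀ * M.riccati t.succ * M.A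

/-- The cost-to-go matrices of a policy `K`:
`P t = Q t + (K t)ᵀ R t (K t) + (A - B K t)ᵀ P (t+1) (A - B K t)`, `P T = Q T`. -/
def policyCost (K : Policy d p T) : Fin (T + 1) → Matrix (Fin d) (Fin d) ℝ :=
  Fin.reverseInduction (motive := fun _ => Matrix (Fin d) (Fin d) ℝ) (M.Q (Fin.last T))
    (fun t P => M.Q t.castSucc + (K t)ᵀ * M.R t * K t
      + (M.A - M.B * K t)ᵀ * P * (M.A - M.B * K t))

/-- The factor `E t = (R t + Bᵀ P (t+1) B) K t - Bᵀ P (t+1) A` of the policy gradient at `K`,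
where `P` are the cost-to-go matrices of `K`. -/
def gradFactor (K : Policy d p T) (t : Fin T) : Matrix (Fin p) (Fin d) ℝ :=
  (M.R t + M.Bᵀ * M.policyCost K t.succ * M.B) * K t - M.Bᵀ * M.policyCost K t.succ * M.A

/-- The state trajectory `x (t+1) = A x t + B u t + w t`, `u t = - K t * x t`, started at `x₀`. -/
def state (K : Policy d p T) (x₀ : Fin d → ℝ) (w : Fin T → Fin d → ℝ) :
    Fin (T + 1) → Fin d → ℝ :=
  Fin.induction (motive := fun _ => Fin d → ℝ) x₀
    (fun t x => M.A *ᵥ x + M.B *ᵥ (-(K t *ᵥ x)) + w t)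

/-- The law of `x t` under policy `K`, when `x₀` has law `P₀` and the noises
`w 0, …, w (T-1)` are i.i.d. with law `ν`, independent of `x₀`. -/
def stateLaw (K : Policy d p T) (P₀ ν : Measure (Fin d → ℝ)) (t : Fin (T + 1)) :
    Measure (Fin d → ℝ) :=
  (P₀.prod (Measure.pi fun _ : Fin T => ν)).map (fun q => M.state K q.1 q.2 t)

/-- Policy-gradient iterates along sampled trajectories (`x ℓ t` is the state at stage `t` of the
trajectory used in iteration `ℓ`), with step sizes `η` and initial policy `K₀`:
`K (ℓ+1) t = K ℓ t - 2 η ℓ E t (K ℓ) (x ℓ t) (x ℓ t)ᵀ`, simultaneously in all stages `t`. -/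
def iterate (η : ℕ → ℝ) (K₀ : Policy d p T) (x : ℕ → Fin (T + 1) → Fin d → ℝ) :
    ℕ → Policy d p T
  | 0 => K₀
  | ℓ + 1 => fun t => iterate η K₀ x ℓ t - (2 * η ℓ) •
      (M.gradFactor (iterate η K₀ x ℓ) t * Matrix.vecMulVec (x ℓ t.castSucc) (x ℓ t.castSucc))

/-- `vec {E t (K⋆) x xᵀ}`. -/
def optScore (t : Fin T) (x : Fin d → ℝ) : Fin d × Fin p → ℝ :=
  (M.gradFactor M.optimalPolicy t * Matrix.vecMulVec x x).vec

end Model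

/-- The second-moment matrix `𝔼[f fᵀ]` of a vector-valued function under `P`. -/
def secondMoment {α ι : Type*} [MeasurableSpace α] (f : α → ι → ℝ) (P : Measure α) :
    Matrix ι ι ℝ :=
  Matrix.of fun i j => ∫ a, f a i * f a j ∂P

namespace Model

variable {d p T : ℕ} (M : Model d p T)

/-- `G t = 𝔼[x t (x t)ᵀ] ⊗ (R t + Bᵀ P⋆ (t+1) B)`, where `x t` has law `Pt`. -/
def G (Pt : Measure (Fin d → ℝ)) (t : Fin T) : Matrix (Fin d × Fin p) (Fin d × Fin p) ℝ :=
  secondMoment (fun x => x) Pt ⊗ₖ (M.R t + M.Bᵀ * M.riccati t.succ * M.B)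

/-- `S t`, the second-moment matrix of `vec {E t (K⋆) x t (x t)ᵀ}`, where `x t` has law `Pt`. -/
def S (Pt : Measure (Fin d → ℝ)) (t : Fin T) : Matrix (Fin d × Fin p) (Fin d × Fin p) ℝ :=
  secondMoment (M.optScore t) Pt

end Model

end

end LQRL

/-! The asserted Gaussian is degenerate. The optimal policy satisfies the normal equation
$(R_t+B^\top P^\star_{t+1}B)K_t^\star=B^\top P^\star_{t+1}A$, and its cost-to-go matrices are the
Riccati matrices. Hence $E_t(K^\star)=0$, $S_t=0$, and the limit law is the Dirac mass at $0$. The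
sampling noise in the gradient is multiplicative and disappears at the optimum. It therefore
suffices that almost surely the errors $e_\ell=K_t^\ell-K_t^\star$ decay faster than every power of
$\ell$: they are then summable, and dividing by $\sqrt n$ sends the partial sums to $0$.

The decay is proved by backward induction on the stage. By `gradFactor_eq`, one update is $e\mapsto
e-2\eta(He+W)xx^\top$, with $H$ the optimal Hessian and $W$ controlled by the error of $P_{t+1}$,
which depends on later stages only. With just two moments of $x$, the mean of $\|e\|^2$ is out of
reach, so the mean of $\|e\|$ is contracted instead: `norm_step_le` truncates the second-order term,
and `exists_mean_contraction` extracts a factor $1-c\eta$ from the positive definiteness of $G_t$.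

Since $n\eta_n\to\infty$, this contraction beats every power of $n$.
`ae_superpolynomialDecay_of_mean_contraction` runs the recursion on adapted events where the
perturbation is already small and passes to almost sure decay by summing expectations.
`ae_superpolynomialDecay_iterate` assembles the induction. -/

namespace LQRL.Model

variable {d p T : ℕ} (M : Model d p T)

/-! ### Riccati matrices, cost-to-go matrices and the gradient at the optimum. -/

@[simp]
lemma riccati_last : M.riccati (Fin.last T) = M.Q (Fin.last T) := by
  simp [riccati]

lemma riccati_castSucc (t : Fin T) :
    M.riccati t.castSucc = M.Q t.castSucc + M.Aᵀ * M.riccati t.succ * M.A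
      - M.Aᵀ * M.riccati t.succ * M.B * (M.Bᵀ * M.riccati t.succ * M.B + M.R t)⁻¹
        * M.Bᵀ * M.riccati t.succ * M.A := by
  simp [riccati]

@[simp]
lemma policyCost_last (K : Policy d p T) : M.policyCost K (Fin.last T) = M.Q (Fin.last T) := by
  simp [policyCost]

lemma policyCost_castSucc (K : Policy d p T) (t : Fin T) :
    M.policyCost K t.castSucc = M.Q t.castSucc + (K t)ᵀ * M.R t * K t
      + (M.A - M.B * K t)ᵀ * M.policyCost K t.succ * (M.A - M.B * K t) := by
  simp [policyCost]

variable {M}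

lemma policyCost_posDef (hM : M.CostPosDef) (K : Policy d p T) (i : Fin (T + 1)) :
    (M.policyCost K i).PosDef := by
  induction i using Fin.reverseInduction with
  | last => simpa using hM.1 _
  | cast t ih =>
    rw [policyCost_castSucc]
    have h₁ := (hM.2 t).posSemidef.conjTranspose_mul_mul_same (K t)
    have h₂ := ih.posSemidef.conjTranspose_mul_mul_same (M.A - M.B * K t)
    rw [Matrix.conjTranspose_eq_transpose_of_trivial] at h₁ h₂
    exact ((hM.1 _).add_posSemidef h₁).add_posSemidef h₂

lemma hessian_posDef (hM : M.CostPosDef) (t : Fin T) {P : Matrix (Fin d) (Fin d) ℝ}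
    (hP : P.PosDef) : (M.R t + M.Bᵀ * P * M.B).PosDef := by
  have h := hP.posSemidef.conjTranspose_mul_mul_same M.B
  rw [Matrix.conjTranspose_eq_transpose_of_trivial] at h
  exact (hM.2 t).add_posSemidef h

lemma hessian_mul_optimalPolicy (t : Fin T)
    (hH : (M.R t + M.Bᵀ * M.riccati t.succ * M.B).PosDef) :
    (M.R t + M.Bᵀ * M.riccati t.succ * M.B) * M.optimalPolicy t
      = M.Bᵀ * M.riccati t.succ * M.A := by
  rw [optimalPolicy, add_comm (M.Bᵀ * M.riccati t.succ * M.B)]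
  simp only [Matrix.mul_assoc] at hH ⊢
  rw [Matrix.mul_nonsing_inv_cancel_left _ _ ((Matrix.isUnit_iff_isUnit_det _).1 hH.isUnit)]

/-- Multiplying the normal equation on the left by $(K_t^\star)^\top$ cancels the terms quadratic in
$K_t^\star$ against one of the two cross terms; the other cross term is the Riccati correction. -/
lemma policyCost_optimalPolicy (hM : M.CostPosDef) (i : Fin (T + 1)) :
    M.policyCost M.optimalPolicy i = M.riccati i := by
  induction i using Fin.reverseInduction with
  | last => simp
  | cast t ih =>
    have hP := policyCost_posDef hM M.optimalPolicy t.succ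
    rw [ih] at hP
    have hK := hessian_mul_optimalPolicy t (hessian_posDef hM t hP)
    rw [policyCost_castSucc, ih, riccati_castSucc]
    have e₁ : M.Aᵀ * M.riccati t.succ * M.B * (M.Bᵀ * M.riccati t.succ * M.B + M.R t)⁻¹
        * M.Bᵀ * M.riccati t.succ * M.A
        = M.Aᵀ * M.riccati t.succ * M.B * M.optimalPolicy t := by
      simp only [optimalPolicy, Matrix.mul_assoc]
    rw [e₁, Matrix.transpose_sub, Matrix.transpose_mul]
    have e₂ := congrArg (fun N => (M.optimalPolicy t)ᵀ * N) hK
    simp only [Matrix.add_mul, Matrix.mul_add] at e₂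
    simp only [Matrix.sub_mul, Matrix.mul_sub, Matrix.mul_assoc] at e₂ ⊢
    rw [← e₂]
    abel

lemma riccati_posDef (hM : M.CostPosDef) (i : Fin (T + 1)) : (M.riccati i).PosDef :=
  policyCost_optimalPolicy hM i ▸ policyCost_posDef hM _ i

lemma optimalHessian_posDef (hM : M.CostPosDef) (t : Fin T) :
    (M.R t + M.Bᵀ * M.riccati t.succ * M.B).PosDef :=
  hessian_posDef hM t (riccati_posDef hM _)

/-- The gradient factor of a policy, expanded at the optimal policy. -/
lemma gradFactor_eq (hM : M.CostPosDef) (K : Policy d p T) (t : Fin T) :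
    M.gradFactor K t = (M.R t + M.Bᵀ * M.riccati t.succ * M.B) * (K t - M.optimalPolicy t)
      + M.Bᵀ * (M.policyCost K t.succ - M.riccati t.succ)
        * (M.B * (K t - M.optimalPolicy t) - (M.A - M.B * M.optimalPolicy t)) := by
  have hK := hessian_mul_optimalPolicy t (optimalHessian_posDef hM t)
  rw [gradFactor, Matrix.mul_sub (M.R t + M.Bᵀ * M.riccati t.succ * M.B), hK]
  simp only [Matrix.add_mul, Matrix.sub_mul, Matrix.mul_sub, Matrix.mul_assoc]
  abel

/-- Both error terms of `gradFactor_eq` vanish. This is the source of the degenerate limit. -/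
lemma gradFactor_optimalPolicy (hM : M.CostPosDef) (t : Fin T) :
    M.gradFactor M.optimalPolicy t = 0 := by
  simp [gradFactor_eq hM, policyCost_optimalPolicy hM]

lemma optScore_eq_zero (hM : M.CostPosDef) (t : Fin T) : M.optScore t = 0 := by
  ext x i
  simp [optScore, gradFactor_optimalPolicy hM]

end LQRL.Model

/-! ### Calculus of convergence faster than every power. -/

namespace LQRL

open Asymptotics

attribute [local instance] Matrix.frobeniusNormedAddCommGroup Matrix.frobeniusNormedSpace

/-- `a n` tends to `b` faster than any power of `n⁻¹`. -/
def RapidlyTendsto (a : ℕ → ℝ) (b : ℝ) : Prop :=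
  SuperpolynomialDecay atTop (fun n : ℕ => (n : ℝ)) (fun n => a n - b)

namespace RapidlyTendsto

variable {a a' : ℕ → ℝ} {b b' : ℝ}

lemma const (b : ℝ) : RapidlyTendsto (fun _ => b) b := by
  simp only [RapidlyTendsto, sub_self]
  exact superpolynomialDecay_zero atTop (fun n : ℕ => (n : ℝ))

lemma add (h : RapidlyTendsto a b) (h' : RapidlyTendsto a' b') :
    RapidlyTendsto (fun n => a n + a' n) (b + b') := by
  refine (SuperpolynomialDecay.add h h').congr fun n => ?_
  simp only [Pi.add_apply]; ring

lemma mul (h : RapidlyTendsto a b) (h' : RapidlyTendsto a' b') :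
    RapidlyTendsto (fun n => a n * a' n) (b * b') := by
  refine ((SuperpolynomialDecay.mul h h').add
    ((SuperpolynomialDecay.const_mul h' b).add (SuperpolynomialDecay.const_mul h b'))).congr
    fun n => ?_
  simp only [Pi.add_apply, Pi.mul_apply]; ring

lemma sub (h : RapidlyTendsto a b) (h' : RapidlyTendsto a' b') :
    RapidlyTendsto (fun n => a n - a' n) (b - b') := by
  simpa [sub_eq_add_neg] using h.add ((const (-1)).mul h')

lemma sum {ι : Type*} (s : Finset ι) {a : ℕ → ι → ℝ} {b : ι → ℝ}
    (h : ∀ i, RapidlyTendsto (fun n => a n i) (b i)) :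
    RapidlyTendsto (fun n => ∑ i ∈ s, a n i) (∑ i ∈ s, b i) := by
  classical
  induction s using Finset.induction_on with
  | empty => simpa using const 0
  | insert i s hi ih => simpa [Finset.sum_insert hi] using (h i).add ih

lemma matrix_mul {l m n : Type*} [Fintype m] (X : ℕ → Matrix l m ℝ) (X' : Matrix l m ℝ)
    (Y : ℕ → Matrix m n ℝ) (Y' : Matrix m n ℝ)
    (hX : ∀ i j, RapidlyTendsto (fun k => X k i j) (X' i j))
    (hY : ∀ i j, RapidlyTendsto (fun k => Y k i j) (Y' i j)) (i : l) (j : n) :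
    RapidlyTendsto (fun k => (X k * Y k) i j) ((X' * Y') i j) := by
  simp only [Matrix.mul_apply]
  exact sum _ fun r => (hX i r).mul (hY r j)

/-- The cost-to-go at stage `i` is a polynomial in the policies of stages `≥ i` alone. Restricting
the hypothesis to those stages is what allows a backward induction. -/
lemma policyCost {d p T : ℕ} (M : Model d p T) {K : ℕ → Policy d p T} {K' : Policy d p T}
    (i : Fin (T + 1))
    (hK : ∀ s : Fin T, i ≤ s.castSucc → ∀ a b, RapidlyTendsto (fun n => K n s a b) (K' s a b))
    (a b : Fin d) :
    RapidlyTendsto (fun n => M.policyCost (K n) i a b) (M.policyCost K' i a b) := by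
  induction i using Fin.reverseInduction generalizing a b with
  | last => simpa using const _
  | cast t ih =>
    have ih' := ih fun s hs => hK s ((Fin.castSucc_lt_succ (i := t)).le.trans hs)
    have ht := hK t le_rfl
    have hA : ∀ a b, RapidlyTendsto (fun n => (M.A - M.B * K n t) a b) ((M.A - M.B * K' t) a b) :=
      fun a b => (const _).sub
        (matrix_mul (fun _ => M.B) M.B (fun n => K n t) (K' t) (fun i j => const _) ht a b)
    simp only [Model.policyCost_castSucc]
    refine ((const _).add ?_).add ?_
    · refine matrix_mul (fun n => (K n t)ᵀ * M.R t) ((K' t)ᵀ * M.R t) (fun n => K n t) (K' t)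
        (matrix_mul (fun n => (K n t)ᵀ) (K' t)ᵀ (fun _ => M.R t) (M.R t) (fun i j => ht j i)
          fun i j => const _) ht a b
    · refine matrix_mul (fun n => (M.A - M.B * K n t)ᵀ * M.policyCost (K n) t.succ)
        ((M.A - M.B * K' t)ᵀ * M.policyCost K' t.succ) (fun n => M.A - M.B * K n t)
        (M.A - M.B * K' t)
        (matrix_mul (fun n => (M.A - M.B * K n t)ᵀ) (M.A - M.B * K' t)ᵀ
          (fun n => M.policyCost (K n) t.succ) (M.policyCost K' t.succ) (fun i j => hA j i) ih')
        hA a b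

end RapidlyTendsto

lemma norm_entry_le {m n : Type*} [Fintype m] [Fintype n] (X : Matrix m n ℝ) (i : m) (j : n) :
    ‖X i j‖ ≤ ‖X‖ := by
  have h₀ : 0 ≤ ∑ i, ∑ j, ‖X i j‖ ^ (2 : ℝ) := by positivity
  rw [Matrix.frobenius_norm_def, ← Real.sqrt_eq_rpow]
  refine Real.le_sqrt_of_sq_le ?_
  simp only [Real.rpow_two]
  exact (Finset.single_le_sum (f := fun j => ‖X i j‖ ^ 2) (fun _ _ => by positivity)
    (Finset.mem_univ j)).trans
    (Finset.single_le_sum (f := fun i => ∑ j, ‖X i j‖ ^ 2) (fun _ _ => by positivity)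
    (Finset.mem_univ i))

lemma norm_le_sum_entries {m n : Type*} [Fintype m] [Fintype n] (X : Matrix m n ℝ) :
    ‖X‖ ≤ ∑ i, ∑ j, ‖X i j‖ := by
  rw [Matrix.frobenius_norm_def, ← Real.sqrt_eq_rpow]
  refine Real.sqrt_le_iff.2 ⟨by positivity, ?_⟩
  simp only [Real.rpow_two]
  calc _ ≤ ∑ i, (∑ j, ‖X i j‖) ^ 2 :=
        Finset.sum_le_sum fun i _ => Finset.sum_sq_le_sq_sum_of_nonneg fun _ _ => norm_nonneg _
    _ ≤ _ := Finset.sum_sq_le_sq_sum_of_nonneg fun _ _ => by positivity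

lemma rapidlyTendsto_entry {m n : Type*} [Fintype m] [Fintype n] {X : ℕ → Matrix m n ℝ}
    {X' : Matrix m n ℝ}
    (h : SuperpolynomialDecay atTop (fun n : ℕ => (n : ℝ)) fun k => ‖X k - X'‖) (i : m) (j : n) :
    RapidlyTendsto (fun k => X k i j) (X' i j) :=
  h.trans_abs_le fun k => by simpa using norm_entry_le (X k - X') i j

/-- Sums and products are handled entrywise, contraction in Frobenius norm; with
`rapidlyTendsto_entry` this passes between the two. -/
lemma superpolynomialDecay_norm {m n : Type*} [Fintype m] [Fintype n] {X : ℕ → Matrix m n ℝ}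
    {X' : Matrix m n ℝ} (h : ∀ i j, RapidlyTendsto (fun k => X k i j) (X' i j)) :
    SuperpolynomialDecay atTop (fun n : ℕ => (n : ℝ)) fun k => ‖X k - X'‖ := by
  have key : RapidlyTendsto (fun k => ∑ i, ∑ j, |X k i j - X' i j|) (∑ _i : m, ∑ _j : n, 0) :=
    RapidlyTendsto.sum _ fun i => RapidlyTendsto.sum _ fun j => by
      have := h i j
      rw [RapidlyTendsto, superpolynomialDecay_iff_superpolynomialDecay_abs] at this
      simpa [RapidlyTendsto, Function.comp_def] using this
  simp only [RapidlyTendsto, Finset.sum_const_zero, sub_zero] at key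
  refine key.trans_abs_le fun k => ?_
  rw [abs_norm, abs_of_nonneg (by positivity)]
  exact norm_le_sum_entries _

/-- Decay below $n^{-2}$ already gives summability, so the partial sums converge and the factor
$1/\sqrt n$ kills them. -/
lemma tendsto_average_zero {E : Type*} [NormedAddCommGroup E] [NormedSpace ℝ E] [CompleteSpace E]
    {e : ℕ → E} (h : SuperpolynomialDecay atTop (fun n : ℕ => (n : ℝ)) fun n => ‖e n‖) :
    Tendsto (fun n : ℕ => (1 / √(n : ℝ)) • ∑ ℓ ∈ Finset.Icc 1 n, e ℓ) atTop (𝓝 0) := by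
  have hs : Summable e := by
    refine Summable.of_norm_bounded_eventually_nat (g := fun n : ℕ => 1 / (n : ℝ) ^ 2)
      (Real.summable_one_div_nat_pow.2 one_lt_two) ?_
    filter_upwards [(h 2).eventually_lt_const one_pos, eventually_gt_atTop 0] with n hn hn0
    rw [le_div_iff₀ (by positivity), mul_comm]
    exact hn.le
  have h₁ : Tendsto (fun n : ℕ => (∑ ℓ ∈ Finset.range (n + 1), e ℓ) - e 0) atTop
      (𝓝 ((∑' n, e n) - e 0)) :=
    (hs.hasSum.tendsto_sum_nat.comp (tendsto_add_atTop_nat 1)).sub_const _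
  have h₂ : Tendsto (fun n : ℕ => 1 / √(n : ℝ)) atTop (𝓝 0) := by
    simpa [Function.comp_def, Pi.inv_def] using
      (Real.tendsto_sqrt_atTop.comp tendsto_natCast_atTop_atTop).inv_tendsto_atTop
  have h₃ := h₂.smul h₁
  rw [zero_smul] at h₃
  refine h₃.congr fun n => ?_
  congr 1
  rw [Finset.sum_range_succ', add_sub_cancel_right, Finset.range_eq_Ico,
    Finset.sum_Ico_add' e 0 n 1]
  rfl

end LQRL

/-! ### Contraction in mean of one stochastic gradient step. -/

namespace LQRL

section Factorization

open scoped MatrixOrder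

/-- With $H=S^\top S$, the inner product of $e$ with $Hexx^\top$ becomes the square $|Sex|^2$. -/
lemma _root_.Matrix.PosDef.exists_eq_transpose_mul_self {n : Type*} [Fintype n] [DecidableEq n]
    {H : Matrix n n ℝ} (hH : H.PosDef) : ∃ S : Matrix n n ℝ, H = Sᵀ * S := by
  obtain ⟨S, hS⟩ := CStarAlgebra.nonneg_iff_eq_star_mul_self.mp hH.posSemidef.nonneg
  exact ⟨S, by simpa [Matrix.star_eq_conjTranspose] using hS⟩

end Factorization

section Frobenius

attribute [local instance] Matrix.frobeniusNormedAddCommGroup Matrix.frobeniusNormedSpace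

variable {m n : Type*} [Fintype m] [Fintype n]

lemma frobenius_norm_sq (X : Matrix m n ℝ) : ‖X‖ ^ 2 = (Xᵀ * X).trace := by
  rw [Matrix.frobenius_norm_def, ← Real.sqrt_eq_rpow, Real.sq_sqrt (by positivity)]
  simp only [Real.rpow_two, Real.norm_eq_abs, sq_abs, Matrix.trace, Matrix.diag, Matrix.mul_apply,
    Matrix.transpose_apply]
  rw [Finset.sum_comm]
  simp only [sq]

lemma frobenius_norm_sq_eq_vec (X : Matrix m n ℝ) : ‖X‖ ^ 2 = X.vec ⬝ᵥ X.vec := by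
  rw [frobenius_norm_sq]
  simp only [Matrix.trace, Matrix.diag, Matrix.mul_apply, Matrix.transpose_apply, dotProduct,
    Fintype.sum_prod_type, Matrix.vec]

lemma norm_vecMulVec_sq (v : m → ℝ) (w : n → ℝ) :
    ‖Matrix.vecMulVec v w‖ ^ 2 = (v ⬝ᵥ v) * (w ⬝ᵥ w) := by
  rw [frobenius_norm_sq, Matrix.transpose_vecMulVec, Matrix.vecMulVec_mul_vecMulVec,
    Matrix.trace_vecMulVec, dotProduct_smul, smul_eq_mul]

lemma dotProduct_self_nonneg (v : n → ℝ) : 0 ≤ v ⬝ᵥ v :=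
  Finset.sum_nonneg fun _ _ => mul_self_nonneg _

lemma norm_vecMulVec_self (v : n → ℝ) : ‖Matrix.vecMulVec v v‖ = v ⬝ᵥ v := by
  rw [← sq_eq_sq₀ (norm_nonneg _) (dotProduct_self_nonneg v), norm_vecMulVec_sq, sq]

lemma mulVec_dotProduct_self_le (N : Matrix m n ℝ) (v : n → ℝ) :
    (N *ᵥ v) ⬝ᵥ (N *ᵥ v) ≤ ‖N‖ ^ 2 * (v ⬝ᵥ v) := by
  -- The vector is viewed as a one-column matrix, so that submultiplicativity applies.
  have h := Matrix.frobenius_norm_mul N (Matrix.vecMulVec v fun _ : Unit => (1 : ℝ))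
  rw [Matrix.mul_vecMulVec] at h
  have h' := pow_le_pow_left₀ (norm_nonneg _) h 2
  rw [mul_pow, norm_vecMulVec_sq, norm_vecMulVec_sq] at h'
  simpa using h'

lemma _root_.Matrix.PosDef.exists_le_quadratic [DecidableEq n] {H : Matrix n n ℝ}
    (hH : H.PosDef) : ∃ c > 0, ∀ v : n → ℝ, c * (v ⬝ᵥ v) ≤ v ⬝ᵥ (H *ᵥ v) := by
  obtain ⟨S, rfl⟩ := hH.exists_eq_transpose_mul_self
  have hS : IsUnit S.det := by
    have := (Matrix.isUnit_iff_isUnit_det _).1 hH.isUnit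
    rw [Matrix.det_mul, Matrix.det_transpose] at this
    exact isUnit_of_mul_isUnit_left this
  -- From $v=S^{-1}Sv$ one gets $|v|^2\le\|S^{-1}\|^2|Sv|^2$; the added $1$ covers an empty index
  -- type.
  refine ⟨1 / (‖S⁻¹‖ ^ 2 + 1), by positivity, fun v => ?_⟩
  have h := mulVec_dotProduct_self_le S⁻¹ (S *ᵥ v)
  rw [Matrix.mulVec_mulVec, Matrix.nonsing_inv_mul _ hS, Matrix.one_mulVec] at h
  have e : v ⬝ᵥ ((Sᵀ * S) *ᵥ v) = (S *ᵥ v) ⬝ᵥ (S *ᵥ v) := by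
    rw [← Matrix.mulVec_mulVec, Matrix.dotProduct_mulVec, Matrix.vecMul_transpose]
  rw [e, div_mul_eq_mul_div, one_mul, div_le_iff₀ (by positivity)]
  nlinarith [dotProduct_self_nonneg (S *ᵥ v)]

/-- The real inequality behind the contraction in mean of one gradient step. -/
lemma contraction_aux {a b Z r η : ℝ} (ha : 0 < a) (hη : 0 ≤ η) (hr : 0 ≤ r)
    (hZr : Z ≤ r * a ^ 2) (h₁ : b ^ 2 ≤ a ^ 2 - 4 * η * Z + 4 * η ^ 2 * r * Z)
    (h₂ : b ≤ a + 2 * η * r * a) :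
    b ≤ a - 2 * η * (Z / a) + 4 * η * (r * min 1 (η * r)) * a := by
  have hZa : Z / a ≤ r * a := by
    rw [div_le_iff₀ ha]; linarith
  have hZ : Z / a * a = Z := div_mul_cancel₀ _ ha.ne'
  generalize Z / a = w at *
  subst hZ
  -- For $\eta r\le1$ the squared bound is linearised by $2ab\le a^2+b^2$. Otherwise the crude bound
  -- suffices, because $2\eta(Z/a)\le2\eta ra$.
  rcases le_total (η * r) 1 with h | h
  · rw [min_eq_right h]
    have h₃ : 2 * a * b ≤ 2 * a * (a - 2 * η * w + 2 * η * (η * r) * w) := by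
      nlinarith [sq_nonneg (a - b)]
    have h₄ := le_of_mul_le_mul_left h₃ (by positivity)
    have h₅ : 2 * η * (η * r) * w ≤ 2 * η * (η * r) * (r * a) :=
      mul_le_mul_of_nonneg_left hZa (by positivity)
    have h₆ : 0 ≤ 2 * η * (η * r) * (r * a) := by positivity
    linarith
  · rw [min_eq_left h]
    have h₅ : 2 * η * w ≤ 2 * η * (r * a) :=
      mul_le_mul_of_nonneg_left hZa (by positivity)
    linarith

/-- Expanding the square gives a gain $4\eta|Sex|^2$ and a loss at most $4\eta^2r|Sex|^2$ with
$r=\|S\|^2|x|^2$. Taking the norm and truncating $\eta r$ at $1$ leaves a remainder at most linear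
in $|x|^2$, hence integrable under two moments. -/
lemma norm_step_le (S : Matrix m m ℝ) (e : Matrix m n ℝ) (x : n → ℝ) {η : ℝ} (hη : 0 ≤ η) :
    ‖e - (2 * η) • (Sᵀ * S * e * Matrix.vecMulVec x x)‖ ≤
      ‖e‖ - 2 * η * ((((S * e) *ᵥ x) ⬝ᵥ ((S * e) *ᵥ x)) / ‖e‖)
        + 4 * η * (‖S‖ ^ 2 * (x ⬝ᵥ x) * min 1 (η * (‖S‖ ^ 2 * (x ⬝ᵥ x)))) * ‖e‖ := by
  rcases eq_or_ne e 0 with rfl | he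
  · simp
  have hx := dotProduct_self_nonneg x
  set z := (S * e) *ᵥ x with hz
  have hY : Sᵀ * S * e * Matrix.vecMulVec x x = Sᵀ * Matrix.vecMulVec z x := by
    rw [hz, ← Matrix.mul_vecMulVec]; simp only [Matrix.mul_assoc]
  have hZr : z ⬝ᵥ z ≤ ‖S‖ ^ 2 * (x ⬝ᵥ x) * ‖e‖ ^ 2 := by
    have h₁ := mulVec_dotProduct_self_le (S * e) x
    have h₂ := pow_le_pow_left₀ (norm_nonneg _) (Matrix.frobenius_norm_mul S e) 2
    rw [mul_pow] at h₂
    nlinarith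
  have hYsq : ‖Sᵀ * Matrix.vecMulVec z x‖ ^ 2 ≤ ‖S‖ ^ 2 * (x ⬝ᵥ x) * (z ⬝ᵥ z) := by
    have h₂ := pow_le_pow_left₀ (norm_nonneg _)
      (Matrix.frobenius_norm_mul Sᵀ (Matrix.vecMulVec z x)) 2
    rw [mul_pow, norm_vecMulVec_sq, Matrix.frobenius_norm_transpose] at h₂
    linarith
  have hin : (eᵀ * (Sᵀ * Matrix.vecMulVec z x)).trace = z ⬝ᵥ z := by
    rw [← Matrix.mul_assoc, ← Matrix.transpose_mul, Matrix.mul_vecMulVec, Matrix.trace_vecMulVec,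
      Matrix.mulVec_transpose, ← Matrix.dotProduct_mulVec]
  rw [hY]
  refine contraction_aux (norm_pos_iff.2 he) hη (by positivity) hZr ?_ ?_
  · have hin' : ((Sᵀ * Matrix.vecMulVec z x)ᵀ * e).trace = z ⬝ᵥ z := by
      rw [← Matrix.trace_transpose, Matrix.transpose_mul, Matrix.transpose_transpose, hin]
    have e₁ : ‖e - (2 * η) • (Sᵀ * Matrix.vecMulVec z x)‖ ^ 2
        = ‖e‖ ^ 2 - 4 * η * (z ⬝ᵥ z) + 4 * η ^ 2 * ‖Sᵀ * Matrix.vecMulVec z x‖ ^ 2 := by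
      rw [frobenius_norm_sq, frobenius_norm_sq e, frobenius_norm_sq (Sᵀ * _)]
      simp only [Matrix.transpose_sub, Matrix.transpose_smul, Matrix.sub_mul, Matrix.mul_sub,
        Matrix.trace_sub, Matrix.smul_mul, Matrix.mul_smul, Matrix.trace_smul, hin, hin',
        smul_eq_mul]
      ring
    rw [e₁]
    nlinarith [sq_nonneg η]
  · refine (norm_sub_le _ _).trans ?_
    rw [norm_smul, Real.norm_of_nonneg (by positivity)]
    have h : ‖Sᵀ * Matrix.vecMulVec z x‖ ≤ ‖S‖ ^ 2 * (x ⬝ᵥ x) * ‖e‖ := by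
      rw [← hY]
      refine (Matrix.frobenius_norm_mul _ _).trans ?_
      rw [norm_vecMulVec_self]
      have h₁ := Matrix.frobenius_norm_mul (Sᵀ * S) e
      have h₂ := Matrix.frobenius_norm_mul Sᵀ S
      rw [Matrix.frobenius_norm_transpose] at h₂
      have h₃ : ‖Sᵀ * S * e‖ ≤ ‖S‖ ^ 2 * ‖e‖ := h₁.trans (by nlinarith [norm_nonneg e])
      nlinarith
    nlinarith

end Frobenius

section OneStep

attribute [local instance] Matrix.frobeniusNormedAddCommGroup Matrix.frobeniusNormedSpace

variable {d p : ℕ} {ρ : Measure (Fin d → ℝ)}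

lemma integrable_mul_coord (h : MemLp (fun x => x) 2 ρ) (i j : Fin d) :
    Integrable (fun x : Fin d → ℝ => x i * x j) ρ := by
  have hc : ∀ i, MemLp (fun x : Fin d → ℝ => x i) 2 ρ := fun i => memLp_pi_iff.1 h i
  exact (hc i).integrable_mul (hc j)

lemma integrable_dotProduct_self (h : MemLp (fun x => x) 2 ρ) :
    Integrable (fun x : Fin d → ℝ => x ⬝ᵥ x) ρ :=
  integrable_finsetSum _ fun i _ => integrable_mul_coord h i i

lemma integrable_mulVec_dotProduct_self (h : MemLp (fun x => x) 2 ρ)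
    (N : Matrix (Fin p) (Fin d) ℝ) :
    Integrable (fun x : Fin d → ℝ => (N *ᵥ x) ⬝ᵥ (N *ᵥ x)) ρ := by
  refine ((integrable_dotProduct_self h).const_mul (‖N‖ ^ 2)).mono
    (Continuous.aestronglyMeasurable (by fun_prop)) (ae_of_all _ fun x => ?_)
  have h₁ := dotProduct_self_nonneg (N *ᵥ x)
  have h₂ := mulVec_dotProduct_self_le N x
  rwa [Real.norm_of_nonneg h₁, Real.norm_of_nonneg (h₁.trans h₂)]

/-- The quadratic form of `𝔼[x xᵀ] ⊗ SᵀS` at `vec e` is `𝔼[|S e x|²]`. -/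
lemma integral_mulVec_dotProduct_self (h : MemLp (fun x => x) 2 ρ)
    (S : Matrix (Fin p) (Fin p) ℝ) (e : Matrix (Fin p) (Fin d) ℝ) :
    ∫ x, ((S * e) *ᵥ x) ⬝ᵥ ((S * e) *ᵥ x) ∂ρ
      = e.vec ⬝ᵥ ((secondMoment (fun x => x) ρ ⊗ₖ (Sᵀ * S)) *ᵥ e.vec) := by
  have hs : (secondMoment (fun x : Fin d → ℝ => x) ρ)ᵀ = secondMoment (fun x => x) ρ := by
    ext i j
    simp [secondMoment, mul_comm]
  rw [Matrix.kronecker_mulVec_vec, hs]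
  have e₁ : e.vec ⬝ᵥ (Sᵀ * S * e * secondMoment (fun x => x) ρ).vec
      = (((S * e)ᵀ * (S * e)) * secondMoment (fun x => x) ρ).trace := by
    rw [Matrix.transpose_mul]
    simp only [Matrix.mul_assoc]
    simp only [Matrix.trace, Matrix.diag, Matrix.mul_apply (M := eᵀ), Matrix.transpose_apply,
      dotProduct, Fintype.sum_prod_type, Matrix.vec]
  rw [e₁]
  have e₂ : ∀ x : Fin d → ℝ, ((S * e) *ᵥ x) ⬝ᵥ ((S * e) *ᵥ x)
      = ∑ i, ∑ j, ((S * e)ᵀ * (S * e)) i j * (x j * x i) := by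
    intro x
    rw [← Matrix.vecMul_transpose (S * e), ← Matrix.dotProduct_mulVec, Matrix.vecMul_transpose,
      Matrix.mulVec_mulVec]
    simp only [dotProduct, Matrix.mulVec, Finset.mul_sum]
    exact Finset.sum_congr rfl fun i _ => Finset.sum_congr rfl fun j _ => by ring
  simp_rw [e₂]
  have hint : ∀ i j, Integrable (fun x : Fin d → ℝ =>
      ((S * e)ᵀ * (S * e)) i j * (x j * x i)) ρ :=
    fun i j => (integrable_mul_coord h j i).const_mul _
  rw [integral_finsetSum _ fun i _ => integrable_finsetSum _ fun j _ => hint i j]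
  simp only [Matrix.trace, Matrix.diag, Matrix.mul_apply (N := secondMoment _ _)]
  refine Finset.sum_congr rfl fun i _ => ?_
  rw [integral_finsetSum _ fun j _ => hint i j]
  refine Finset.sum_congr rfl fun j _ => ?_
  rw [integral_const_mul]
  simp [secondMoment]

/-- Dominated convergence with dominating function $c^2|x|^2$: the second-order loss is $o(\eta)$
without fourth moments. -/
lemma tendsto_integral_mul_min (h : MemLp (fun x => x) 2 ρ) (c : ℝ) :
    Tendsto (fun η => ∫ x : Fin d → ℝ, c ^ 2 * (x ⬝ᵥ x) * min 1 (η * (c ^ 2 * (x ⬝ᵥ x))) ∂ρ)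
      (𝓝[>] 0) (𝓝 0) := by
  have key := tendsto_integral_filter_of_dominated_convergence (μ := ρ) (l := 𝓝[>] (0 : ℝ))
    (F := fun η (x : Fin d → ℝ) => c ^ 2 * (x ⬝ᵥ x) * min 1 (η * (c ^ 2 * (x ⬝ᵥ x))))
    (f := fun _ => 0) (fun x => c ^ 2 * (x ⬝ᵥ x))
    (Eventually.of_forall fun η => Continuous.aestronglyMeasurable (by fun_prop)) ?_
    ((integrable_dotProduct_self h).const_mul _) ?_
  · simpa using key
  · filter_upwards [self_mem_nhdsWithin] with η hη
    refine ae_of_all _ fun x => ?_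
    have hx := dotProduct_self_nonneg x
    have hη' : 0 < η := hη
    have hm : 0 ≤ min 1 (η * (c ^ 2 * (x ⬝ᵥ x))) := le_min zero_le_one (by positivity)
    rw [Real.norm_of_nonneg (by positivity)]
    exact mul_le_of_le_one_right (by positivity) (min_le_left _ _)
  · refine ae_of_all _ fun x => ?_
    have hc : Continuous fun η : ℝ => c ^ 2 * (x ⬝ᵥ x) * min 1 (η * (c ^ 2 * (x ⬝ᵥ x))) := by
      fun_prop
    simpa using (hc.tendsto 0).mono_left nhdsWithin_le_nhds

/-- One gradient step with a small step size contracts the error in mean. -/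
lemma exists_mean_contraction (h : MemLp (fun x => x) 2 ρ) [IsProbabilityMeasure ρ]
    (hρ : (secondMoment (fun x => x) ρ).PosDef) {H : Matrix (Fin p) (Fin p) ℝ} (hH : H.PosDef) :
    ∃ c > 0, ∃ m ≥ 0, ∀ᶠ η in 𝓝[>] (0 : ℝ), ∀ e W : Matrix (Fin p) (Fin d) ℝ,
      ∫⁻ x, ‖e - (2 * η) • ((H * e + W) * Matrix.vecMulVec x x)‖ₑ ∂ρ
        ≤ ENNReal.ofReal ((1 - c * η) * ‖e‖ + m * η * ‖W‖) := by
  obtain ⟨S, rfl⟩ := hH.exists_eq_transpose_mul_self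
  obtain ⟨c, hc, hcG⟩ := (hρ.kronecker hH).exists_le_quadratic
  have hq := integrable_dotProduct_self h
  refine ⟨c, hc, 2 * ∫ x, x ⬝ᵥ x ∂ρ,
    mul_nonneg two_pos.le (integral_nonneg fun x => dotProduct_self_nonneg x), ?_⟩
  -- The gain in mean is at least $2c\eta\|e\|$. The threshold $c/4$ limits the truncated loss to
  -- $c\eta\|e\|$, leaving the rate $c\eta$.
  filter_upwards [self_mem_nhdsWithin,
    (tendsto_integral_mul_min h ‖S‖).eventually_lt_const (show 0 < c / 4 by positivity)]
    with η hη hI e W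
  have hη' : 0 < η := hη
  have hZ := integrable_mulVec_dotProduct_self h (S * e)
  have hM : Integrable (fun x : Fin d → ℝ =>
      ‖S‖ ^ 2 * (x ⬝ᵥ x) * min 1 (η * (‖S‖ ^ 2 * (x ⬝ᵥ x)))) ρ := by
    refine (hq.const_mul (‖S‖ ^ 2)).mono (Continuous.aestronglyMeasurable (by fun_prop))
      (ae_of_all _ fun x => ?_)
    have hx := dotProduct_self_nonneg x
    have hm : 0 ≤ min 1 (η * (‖S‖ ^ 2 * (x ⬝ᵥ x))) := le_min zero_le_one (by positivity)
    rw [Real.norm_of_nonneg (by positivity), Real.norm_of_nonneg (by positivity)]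
    exact mul_le_of_le_one_right (by positivity) (min_le_left _ _)
  have hb : ∀ x : Fin d → ℝ, ‖e - (2 * η) • ((Sᵀ * S * e + W) * Matrix.vecMulVec x x)‖ ≤
      ‖e‖ - 2 * η * ((((S * e) *ᵥ x) ⬝ᵥ ((S * e) *ᵥ x)) / ‖e‖)
        + 4 * η * (‖S‖ ^ 2 * (x ⬝ᵥ x) * min 1 (η * (‖S‖ ^ 2 * (x ⬝ᵥ x)))) * ‖e‖
        + 2 * η * ‖W‖ * (x ⬝ᵥ x) := by
    intro x
    have h₁ := norm_step_le S e x hη'.le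
    have h₂ : ‖(2 * η) • (W * Matrix.vecMulVec x x)‖ ≤ 2 * η * ‖W‖ * (x ⬝ᵥ x) := by
      rw [norm_smul, Real.norm_of_nonneg (by positivity), mul_assoc (2 * η)]
      refine mul_le_mul_of_nonneg_left ?_ (by positivity)
      exact (Matrix.frobenius_norm_mul _ _).trans_eq (by rw [norm_vecMulVec_self])
    rw [Matrix.add_mul, smul_add, ← sub_sub]
    exact (norm_sub_le _ _).trans (add_le_add h₁ h₂)
  have hi₀ : Integrable (fun x : Fin d → ℝ =>
      ‖e‖ - 2 * η * ((((S * e) *ᵥ x) ⬝ᵥ ((S * e) *ᵥ x)) / ‖e‖)) ρ :=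
    (integrable_const _).sub ((hZ.div_const ‖e‖).const_mul (2 * η))
  have hi₁ : Integrable (fun x : Fin d → ℝ =>
      ‖e‖ - 2 * η * ((((S * e) *ᵥ x) ⬝ᵥ ((S * e) *ᵥ x)) / ‖e‖)
        + 4 * η * (‖S‖ ^ 2 * (x ⬝ᵥ x) * min 1 (η * (‖S‖ ^ 2 * (x ⬝ᵥ x)))) * ‖e‖) ρ :=
    hi₀.add ((hM.const_mul (4 * η)).mul_const ‖e‖)
  have hi := hi₁.add (hq.const_mul (2 * η * ‖W‖))
  refine (lintegral_mono fun x => ?_).trans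
    ((ofReal_integral_eq_lintegral_ofReal hi (ae_of_all _ fun x => ?_)).ge.trans ?_)
  · rw [← ofReal_norm]
    exact ENNReal.ofReal_le_ofReal (hb x)
  · exact (norm_nonneg _).trans (hb x)
  · refine ENNReal.ofReal_le_ofReal ?_
    rw [integral_add' hi₁ (hq.const_mul _), integral_add hi₀ ((hM.const_mul (4 * η)).mul_const ‖e‖),
      integral_sub (integrable_const _) ((hZ.div_const ‖e‖).const_mul (2 * η)),
      integral_const, integral_const_mul, integral_div, integral_mul_const, integral_const_mul,
      integral_const_mul, integral_mulVec_dotProduct_self h, probReal_univ, one_smul]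
    have h₁ := hcG e.vec
    rw [← frobenius_norm_sq_eq_vec] at h₁
    have h₂ : c * ‖e‖ ≤
        (e.vec ⬝ᵥ ((secondMoment (fun x => x) ρ ⊗ₖ (Sᵀ * S)) *ᵥ e.vec)) / ‖e‖ := by
      rcases eq_or_ne e 0 with rfl | he
      · simp
      · rw [le_div_iff₀ (norm_pos_iff.2 he)]; linarith
    have h₃ := mul_le_mul_of_nonneg_left h₂ (show 0 ≤ 2 * η by positivity)
    have h₄ := mul_le_mul_of_nonneg_left hI.le (show 0 ≤ 4 * η * ‖e‖ by positivity)
    linarith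

end OneStep

end LQRL

/-! ### From contraction in mean to almost sure decay. -/

namespace LQRL

open Asymptotics
open scoped ENNReal

/-- Bernoulli's inequality for $(1-1/(n+1))^k=(n/(n+1))^k$. -/
lemma one_sub_div_mul_inv_pow_le (k n : ℕ) (hn : 0 < n) :
    (1 - (k : ℝ) / (n + 1)) * ((n : ℝ) ^ k)⁻¹ ≤ (((n + 1 : ℕ) : ℝ) ^ k)⁻¹ := by
  have hn' : (0 : ℝ) < n := by exact_mod_cast hn
  have hb := one_add_mul_le_pow (a := -(1 / ((n : ℝ) + 1))) (by
    have : 1 / ((n : ℝ) + 1) ≤ 1 := by rw [div_le_one (by positivity)]; linarith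
    linarith) k
  have e : 1 + -(1 / ((n : ℝ) + 1)) = n / (n + 1) := by field_simp; ring
  rw [e, div_pow] at hb
  rw [← div_eq_mul_inv, div_le_iff₀ (by positivity)]
  push_cast
  calc 1 - (k : ℝ) / (n + 1) = 1 + k * -(1 / ((n : ℝ) + 1)) := by ring
    _ ≤ _ := hb
    _ = _ := by rw [div_eq_inv_mul]

/-- Polynomial decay of a sequence satisfying a contractive recursion. -/
lemma exists_le_inv_pow_of_rec {u : ℕ → ℝ≥0∞} {η : ℕ → ℝ} {c m L : ℝ} {k N : ℕ} (hc : 0 < c)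
    (hm : 0 ≤ m) (hL : 0 ≤ L) (hN : 0 < N) (h0 : ∀ n ≥ N, 0 ≤ η n) (h1 : ∀ n ≥ N, c * η n ≤ 1)
    (hk : ∀ n ≥ N, (k : ℝ) / (n + 1) ≤ c / 2 * η n) (hu : u N ≤ ENNReal.ofReal L)
    (hrec : ∀ n ≥ N, u (n + 1) ≤ ENNReal.ofReal (1 - c * η n) * u n
      + ENNReal.ofReal (m * η n * ((n : ℝ) ^ k)⁻¹)) :
    ∃ K ≥ 0, ∀ n ≥ N, u n ≤ ENNReal.ofReal (K * ((n : ℝ) ^ k)⁻¹) := by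
  -- The first entry settles the base case. The second makes the perturbation cost at most half of
  -- the contraction; the other half dominates $k/(n+1)$.
  refine ⟨max (L * N ^ k) (2 * m / c), le_max_of_le_right (by positivity), fun n hn => ?_⟩
  set K := max (L * N ^ k) (2 * m / c) with hK
  have hK0 : 0 ≤ K := le_max_of_le_right (by positivity)
  have hKm : m ≤ K * (c / 2) := by
    have := le_max_right (L * N ^ k) (2 * m / c)
    rw [← hK, div_le_iff₀ hc] at this
    linarith
  induction n, hn using Nat.le_induction with
  | base =>
    refine hu.trans (ENNReal.ofReal_le_ofReal ?_)
    have hN' : (0 : ℝ) < N := by exact_mod_cast hN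
    rw [← div_eq_mul_inv, le_div_iff₀ (by positivity)]
    exact le_max_left _ _
  | succ n hn ih =>
    have hn' : 0 < n := hN.trans_le hn
    refine (hrec n hn).trans ?_
    have hq : 0 ≤ ((n : ℝ) ^ k)⁻¹ := by positivity
    have hη := h0 n hn
    refine (add_le_add_left (mul_le_mul_right ih _) _).trans ?_
    rw [← ENNReal.ofReal_mul (by linarith [h1 n hn]), ← ENNReal.ofReal_add
      (mul_nonneg (by linarith [h1 n hn]) (by positivity)) (by positivity)]
    refine ENNReal.ofReal_le_ofReal ?_
    refine le_trans ?_ (mul_le_mul_of_nonneg_left (one_sub_div_mul_inv_pow_le k n hn') hK0)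
    have h2 : K * ((k : ℝ) / (n + 1)) ≤ K * (c / 2 * η n) :=
      mul_le_mul_of_nonneg_left (hk n hn) hK0
    have h3 : m * η n ≤ K * (c / 2) * η n := mul_le_mul_of_nonneg_right hKm hη
    have h4 : (1 - c * η n) * K + m * η n ≤ K * (1 - (k : ℝ) / (n + 1)) := by linarith
    have h5 := mul_le_mul_of_nonneg_right h4 hq
    linarith

/-- A nonnegative adapted process that contracts in mean, up to a rapidly decaying perturbation,
decays rapidly almost surely. -/
lemma ae_superpolynomialDecay_of_mean_contraction {Ω : Type*} [mΩ : MeasurableSpace Ω]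
    {μ : Measure Ω} [IsProbabilityMeasure μ] (ℱ : Filtration ℕ mΩ) {e D : ℕ → Ω → ℝ}
    (he0 : ∀ n ω, 0 ≤ e n ω) (he : ∀ n, Measurable[ℱ n] (e n))
    (hD : ∀ n, Measurable[ℱ n] (D n)) {η : ℕ → ℝ} (hη : Tendsto η atTop (𝓝 0))
    (hη' : Tendsto (fun n : ℕ => ((n : ℝ) + 1) * η n) atTop atTop) {c m δ : ℝ} (hc : 0 < c)
    (hm : 0 ≤ m) (hδ : 0 < δ)
    (hstep : ∀ᶠ n in atTop, ∀ A, MeasurableSet[ℱ n] A → (∀ ω ∈ A, D n ω ≤ δ) →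
      ∫⁻ ω in A, ENNReal.ofReal (e (n + 1) ω) ∂μ ≤
        ENNReal.ofReal (1 - c * η n) * ∫⁻ ω in A, ENNReal.ofReal (e n ω) ∂μ
          + ENNReal.ofReal (m * η n) * ∫⁻ ω in A, ENNReal.ofReal (D n ω) ∂μ)
    (hDdecay : ∀ᵐ ω ∂μ, SuperpolynomialDecay atTop (fun n : ℕ => (n : ℝ)) fun n => D n ω) :
    ∀ᵐ ω ∂μ, SuperpolynomialDecay atTop (fun n : ℕ => (n : ℝ)) fun n => e n ω := by
  have hη0 : ∀ᶠ n in atTop, 0 ≤ η n := by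
    filter_upwards [hη'.eventually_ge_atTop 0] with n hn
    exact nonneg_of_mul_nonneg_right hn (by positivity)
  have hη1 : ∀ᶠ n in atTop, c * η n ≤ 1 := by
    have := hη.const_mul c
    rw [mul_zero] at this
    exact (this.eventually_lt_const one_pos).mono fun n hn => hn.le
  have hηk : ∀ k : ℕ, ∀ᶠ n : ℕ in atTop, (k : ℝ) / (n + 1) ≤ c / 2 * η n := by
    intro k
    filter_upwards [hη'.eventually_ge_atTop (2 * k / c)] with n hn
    rw [div_le_iff₀ hc] at hn
    rw [div_le_iff₀ (by positivity)]
    linarith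
  have key : ∀ j : ℕ, ∃ N₀ : ℕ, ∀ N ≥ N₀, ∀ L : ℕ, ∀ᵐ ω ∂μ, e N ω ≤ L →
      (∀ n ≥ N, D n ω ≤ δ ∧ (n : ℝ) ^ (j + 2) * D n ω ≤ 1) →
      Tendsto (fun n : ℕ => (n : ℝ) ^ j * e n ω) atTop (𝓝 0) := by
    intro j
    obtain ⟨N₀, hN₀⟩ := eventually_atTop.1 ((eventually_gt_atTop 0).and
      (hη0.and (hη1.and ((hηk (j + 2)).and hstep))))
    refine ⟨N₀, fun N hN L => ?_⟩
    have hN' : ∀ n ≥ N, _ := fun n hn => hN₀ n (le_trans hN hn)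
    -- Localisation: these events decrease in `n` and are known at time `n`, so the mean recursion
    -- restricts to them. The bound `L` gives a finite start, and there `D` is at most $n^{-(j+2)}$.
    let A : ℕ → Set Ω := fun n => {ω | e N ω ≤ L} ∩
      ⋂ i ∈ Finset.Icc N n, {ω | D i ω ≤ δ ∧ (i : ℝ) ^ (j + 2) * D i ω ≤ 1}
    have hA : ∀ n ≥ N, MeasurableSet[ℱ n] (A n) := by
      intro n hn
      refine MeasurableSet.inter ?_ (Finset.measurableSet_biInter _ fun i hi => ?_)
      · exact ℱ.mono hn _ (he N measurableSet_Iic)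
      · have hDi : Measurable[ℱ n] (D i) := (hD i).mono (ℱ.mono (Finset.mem_Icc.1 hi).2) le_rfl
        exact (hDi measurableSet_Iic).inter
          ((hDi.const_mul ((i : ℝ) ^ (j + 2))) measurableSet_Iic)
    have hAsub : ∀ n, A (n + 1) ⊆ A n := fun n =>
      Set.inter_subset_inter_right _ (Set.biInter_subset_biInter_left
        (Finset.Icc_subset_Icc_right n.le_succ))
    have hAD : ∀ n ≥ N, ∀ ω ∈ A n, D n ω ≤ δ ∧ (n : ℝ) ^ (j + 2) * D n ω ≤ 1 := fun n hn ω hω =>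
      Set.mem_iInter₂.1 hω.2 n (Finset.mem_Icc.2 ⟨hn, le_rfl⟩)
    obtain ⟨K, hK0, hK⟩ := exists_le_inv_pow_of_rec (k := j + 2) (L := L) (m := m) (η := η)
      (u := fun n => ∫⁻ ω in A n, ENNReal.ofReal (e n ω) ∂μ) hc hm (by positivity)
      (hN' N le_rfl).1 (fun n hn => (hN' n hn).2.1) (fun n hn => (hN' n hn).2.2.1)
      (fun n hn => (hN' n hn).2.2.2.1) (by
        refine (setLIntegral_mono measurable_const fun ω hω =>
          ENNReal.ofReal_le_ofReal hω.1).trans ?_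
        rw [setLIntegral_const]
        exact mul_le_of_le_one_right' prob_le_one) (by
        intro n hn
        refine (lintegral_mono_set (hAsub n)).trans
          (((hN' n hn).2.2.2.2 (A n) (hA n hn) fun ω hω => (hAD n hn ω hω).1).trans ?_)
        refine add_le_add le_rfl ?_
        have hn0 : (0 : ℝ) < n := by exact_mod_cast (hN' n hn).1
        rw [ENNReal.ofReal_mul (mul_nonneg hm (hN' n hn).2.1)]
        gcongr
        refine (setLIntegral_mono measurable_const fun ω hω => ENNReal.ofReal_le_ofReal
          (q := ((n : ℝ) ^ (j + 2))⁻¹) ?_).trans ?_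
        · rw [← one_div, le_div_iff₀ (by positivity), mul_comm]
          exact (hAD n hn ω hω).2
        · rw [setLIntegral_const]
          exact mul_le_of_le_one_right' prob_le_one)
    have hmeas : ∀ n, Measurable ((A (n + N)).indicator fun ω =>
        ENNReal.ofReal (((n + N : ℕ) : ℝ) ^ j * e (n + N) ω)) := fun n =>
      ((((he _).mono (ℱ.le _) le_rfl).const_mul _).ennreal_ofReal).indicator
        (ℱ.le _ _ (hA _ (Nat.le_add_left _ _)))
    -- The two spare powers make the localised means of $n^je_n$ at most $Kn^{-2}$. Their sum is
    -- finite, so the series converges almost surely and its terms tend to $0$.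
    have hfin : ∫⁻ ω, ∑' n : ℕ, (A (n + N)).indicator (fun ω =>
        ENNReal.ofReal (((n + N : ℕ) : ℝ) ^ j * e (n + N) ω)) ω ∂μ ≠ ∞ := by
      rw [lintegral_tsum fun n => (hmeas n).aemeasurable]
      have hsum : Summable fun n : ℕ => K * (((n + N : ℕ) : ℝ) ^ 2)⁻¹ :=
        ((summable_nat_add_iff N).2 (Real.summable_nat_pow_inv.2 one_lt_two)).mul_left K
      refine ne_top_of_le_ne_top hsum.tsum_ofReal_ne_top (ENNReal.tsum_le_tsum fun n => ?_)
      have hn : N ≤ n + N := Nat.le_add_left _ _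
      have hn0 : (0 : ℝ) < (n + N : ℕ) := by exact_mod_cast (hN' _ hn).1
      rw [lintegral_indicator (ℱ.le _ _ (hA _ hn))]
      simp_rw [ENNReal.ofReal_mul (pow_nonneg hn0.le j)]
      rw [lintegral_const_mul _ ((he _).mono (ℱ.le _) le_rfl).ennreal_ofReal]
      refine (mul_le_mul_right (hK _ hn) _).trans ?_
      rw [← ENNReal.ofReal_mul (by positivity)]
      refine ENNReal.ofReal_le_ofReal (le_of_eq ?_)
      field_simp
      ring
    filter_upwards [ae_lt_top (Measurable.tsum hmeas) hfin] with ω hω heL hDω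
    have ht := ENNReal.tendsto_atTop_zero_of_tsum_ne_top hω.ne
    have hmem : ∀ n, ω ∈ A n := fun n =>
      ⟨heL, Set.mem_iInter₂.2 fun i hi => hDω i (Finset.mem_Icc.1 hi).1⟩
    simp only [Set.indicator_of_mem (hmem _)] at ht
    have ht' := (ENNReal.tendsto_toReal ENNReal.zero_ne_top).comp ht
    rw [← tendsto_add_atTop_iff_nat N]
    refine ht'.congr fun n => ?_
    exact ENNReal.toReal_ofReal (mul_nonneg (by positivity) (he0 _ _))
  choose N₀ hN₀ using key
  have hall : ∀ᵐ ω ∂μ, ∀ j N L : ℕ, N₀ j ≤ N → e N ω ≤ L →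
      (∀ n ≥ N, D n ω ≤ δ ∧ (n : ℝ) ^ (j + 2) * D n ω ≤ 1) →
      Tendsto (fun n : ℕ => (n : ℝ) ^ j * e n ω) atTop (𝓝 0) := by
    simp only [ae_all_iff]
    exact fun j N L hN => hN₀ j N hN L
  -- Only countably many triples `(j, N, L)` occur, and almost every `ω` lies in all localising
  -- events for a suitable `N` and `L`.
  filter_upwards [hall, hDdecay] with ω hω hDω j
  have h0 := hDω 0
  simp only [pow_zero, one_mul] at h0
  obtain ⟨N₁, hN₁⟩ := eventually_atTop.1 ((h0.eventually_lt_const hδ).and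
    ((hDω (j + 2)).eventually_lt_const one_pos))
  exact hω j (max (N₀ j) N₁) ⌈e (max (N₀ j) N₁) ω⌉₊ (le_max_left _ _) (Nat.le_ceil _) fun n hn =>
    ⟨(hN₁ n ((le_max_right _ _).trans hn)).1.le, (hN₁ n ((le_max_right _ _).trans hn)).2.le⟩

end LQRL

/-! ### Independence, second moments and laws of the sampled states. -/

namespace LQRL

open scoped ENNReal

section Independence

lemma indepFun_of_measurable_iSup_comap {Ω ι E β γ : Type*} [MeasurableSpace Ω]
    {μ : Measure Ω} [MeasurableSpace E] [MeasurableSpace β]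
    [MeasurableSpace γ] {f : ι → Ω → E} (hf : ∀ i, Measurable (f i)) (h : iIndepFun f μ)
    {S S' : Set ι} (hS : Disjoint S S') {X : Ω → β} {Y : Ω → γ}
    (hX : Measurable[⨆ i ∈ S, MeasurableSpace.comap (f i) inferInstance] X)
    (hY : Measurable[⨆ i ∈ S', MeasurableSpace.comap (f i) inferInstance] Y) :
    IndepFun X Y μ := by
  have h' := indep_iSup_of_disjoint (fun i => (hf i).comap_le) h hS
  exact indep_of_indep_of_le_left (indep_of_indep_of_le_right h' hY.comap_le) hX.comap_le

lemma measurable_iSup_comap {Ω ι E : Type*} [MeasurableSpace E] (f : ι → Ω → E) {S : Set ι} {i : ι}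
    (hi : i ∈ S) : Measurable[⨆ i ∈ S, MeasurableSpace.comap (f i) inferInstance] (f i) :=
  measurable_iff_comap_le.2
    (le_iSup₂ (f := fun i (_ : i ∈ S) => MeasurableSpace.comap (f i) inferInstance) i hi)

/-- Fubini for a function of a variable known at time `m₁` and an independent variable. -/
lemma setLIntegral_eq_of_indep {Ω β γ : Type*} [MeasurableSpace β] [MeasurableSpace γ]
    {m₁ mΩ : MeasurableSpace Ω} {μ : Measure Ω} [IsProbabilityMeasure μ] (hm : m₁ ≤ mΩ) {Y : Ω → β} {X : Ω → γ}
    (hY : Measurable[m₁] Y) (hX : Measurable X)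
    (hind : Indep m₁ (MeasurableSpace.comap X inferInstance) μ) {Φ : β × γ → ℝ≥0∞}
    (hΦ : Measurable Φ) {A : Set Ω} (hA : MeasurableSet[m₁] A) :
    ∫⁻ ω in A, Φ (Y ω, X ω) ∂μ = ∫⁻ ω in A, ∫⁻ x, Φ (Y ω, x) ∂(μ.map X) ∂μ := by
  -- Carrying the indicator of `A` along with `Y` reduces the integral over `A` to Fubini for one
  -- independent pair.
  let Y' : Ω → β × ℝ≥0∞ := fun ω => (Y ω, A.indicator 1 ω)
  have hY' : Measurable[m₁] Y' :=
    (fun (m : MeasurableSpace Ω) (h : Measurable[m] Y) (hA : MeasurableSet[m] A) =>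
      h.prodMk (measurable_one.indicator hA)) m₁ hY hA
  have hY'' : Measurable Y' := hY'.mono hm le_rfl
  have hi : IndepFun Y' X μ := indep_of_indep_of_le_left hind hY'.comap_le
  have hmap := (indepFun_iff_map_prod_eq_prod_map_map hY''.aemeasurable hX.aemeasurable).1 hi
  have hΨ : Measurable fun q : (β × ℝ≥0∞) × γ => q.1.2 * Φ (q.1.1, q.2) := by fun_prop
  have : IsProbabilityMeasure (μ.map X) := Measure.isProbabilityMeasure_map hX.aemeasurable
  calc ∫⁻ ω in A, Φ (Y ω, X ω) ∂μ
      = ∫⁻ ω, (fun q : (β × ℝ≥0∞) × γ => q.1.2 * Φ (q.1.1, q.2)) (Y' ω, X ω) ∂μ := by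
        rw [← lintegral_indicator (hm _ hA)]
        refine lintegral_congr fun ω => ?_
        by_cases h : ω ∈ A <;> simp [Y', h]
    _ = ∫⁻ y, ∫⁻ x, y.2 * Φ (y.1, x) ∂(μ.map X) ∂(μ.map Y') := by
        rw [← lintegral_map hΨ (hY''.prodMk hX), hmap, lintegral_prod _ hΨ.aemeasurable]
    _ = ∫⁻ ω, ∫⁻ x, A.indicator 1 ω * Φ (Y ω, x) ∂(μ.map X) ∂μ :=
        lintegral_map hΨ.lintegral_prod_right' hY''
    _ = _ := by
        rw [← lintegral_indicator (hm _ hA)]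
        refine lintegral_congr fun ω => ?_
        by_cases h : ω ∈ A <;> simp [h]

end Independence

section SecondMoment

variable {d : ℕ}

lemma dotProduct_secondMoment_mulVec {Ω : Type*} [MeasurableSpace Ω] {μ : Measure Ω}
    {X : Ω → Fin d → ℝ} (h : MemLp X 2 μ) (v : Fin d → ℝ) :
    v ⬝ᵥ (secondMoment X μ *ᵥ v) = ∫ ω, (v ⬝ᵥ X ω) ^ 2 ∂μ := by
  have hc : ∀ i, MemLp (fun ω => X ω i) 2 μ := fun i => memLp_pi_iff.1 h i
  have hint : ∀ i j, Integrable (fun ω => v i * (X ω i * X ω j * v j)) μ :=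
    fun i j => (((hc i).integrable_mul (hc j)).mul_const _).const_mul _
  have e : ∀ ω, (v ⬝ᵥ X ω) ^ 2 = ∑ i, ∑ j, v i * (X ω i * X ω j * v j) := fun ω => by
    rw [sq, dotProduct, Finset.sum_mul_sum]
    exact Finset.sum_congr rfl fun i _ => Finset.sum_congr rfl fun j _ => by ring
  simp_rw [e]
  rw [integral_finsetSum _ fun i _ => integrable_finsetSum _ fun j _ => hint i j]
  simp only [dotProduct, Matrix.mulVec, Finset.mul_sum]
  refine Finset.sum_congr rfl fun i _ => ?_
  rw [integral_finsetSum _ fun j _ => hint i j]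
  refine Finset.sum_congr rfl fun j _ => ?_
  rw [integral_const_mul, integral_mul_const]
  rfl

lemma secondMoment_posDef {Ω : Type*} [MeasurableSpace Ω] {μ : Measure Ω} {X : Ω → Fin d → ℝ}
    (h : MemLp X 2 μ) (hpos : ∀ v ≠ 0, 0 < ∫ ω, (v ⬝ᵥ X ω) ^ 2 ∂μ) :
    (secondMoment X μ).PosDef := by
  refine Matrix.PosDef.of_dotProduct_mulVec_pos ?_ fun v hv => ?_
  · ext i j
    simp [secondMoment, mul_comm]
  · simpa [dotProduct_secondMoment_mulVec h] using hpos v hv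

lemma integral_sq_pos_of_posDef {Ω : Type*} [MeasurableSpace Ω] {μ : Measure Ω}
    {X : Ω → Fin d → ℝ} (h : MemLp X 2 μ) (hX : (secondMoment X μ).PosDef) {v : Fin d → ℝ}
    (hv : v ≠ 0) : 0 < ∫ ω, (v ⬝ᵥ X ω) ^ 2 ∂μ := by
  rw [← dotProduct_secondMoment_mulVec h]
  simpa using hX.dotProduct_mulVec_pos hv

lemma memLp_of_hasLaw {Ω : Type*} [MeasurableSpace Ω] {μ : Measure Ω} {X : Ω → Fin d → ℝ}
    {P : Measure (Fin d → ℝ)} (hX : HasLaw X P μ) :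
    MemLp (fun x => x) 2 P ↔ MemLp X 2 μ := by
  rw [← hX.map_eq]
  exact memLp_map_measure_iff (by fun_prop) hX.aemeasurable

lemma secondMoment_of_hasLaw {Ω : Type*} [MeasurableSpace Ω] {μ : Measure Ω} {X : Ω → Fin d → ℝ}
    {P : Measure (Fin d → ℝ)} (hX : HasLaw X P μ) :
    secondMoment (fun x => x) P = secondMoment X μ := by
  ext i j
  exact (hX.integral_comp (f := fun x => x i * x j)
    (Continuous.aestronglyMeasurable (by fun_prop))).symm

lemma memLp_dotProduct {Ω : Type*} [MeasurableSpace Ω] {μ : Measure Ω} {X : Ω → Fin d → ℝ}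
    (h : MemLp X 2 μ) (v : Fin d → ℝ) : MemLp (fun ω => v ⬝ᵥ X ω) 2 μ :=
  memLp_finsetSum _ fun i _ => (memLp_pi_iff.1 h i).const_mul _

lemma memLp_mulVec {m : ℕ} {Ω : Type*} [MeasurableSpace Ω] {μ : Measure Ω} {X : Ω → Fin d → ℝ}
    (h : MemLp X 2 μ) (N : Matrix (Fin m) (Fin d) ℝ) : MemLp (fun ω => N *ᵥ X ω) 2 μ :=
  memLp_pi_iff.2 fun i => memLp_dotProduct h (N i)

end SecondMoment

namespace Model

variable {d p T : ℕ} (M : Model d p T) (K : Policy d p T)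

@[simp]
lemma state_zero (x₀ : Fin d → ℝ) (w : Fin T → Fin d → ℝ) : M.state K x₀ w 0 = x₀ := by
  simp [state]

lemma state_succ (x₀ : Fin d → ℝ) (w : Fin T → Fin d → ℝ) (t : Fin T) :
    M.state K x₀ w t.succ = (M.A - M.B * K t) *ᵥ M.state K x₀ w t.castSucc + w t := by
  simp only [state, Fin.induction_succ]
  rw [Matrix.sub_mulVec, ← Matrix.mulVec_mulVec, Matrix.mulVec_neg, sub_eq_add_neg]

/-- The σ-algebra is left free and only noises strictly before `t` enter, so it can be generated by
whichever inputs an independence argument allows. -/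
lemma measurable_state {Ω : Type*} {m : MeasurableSpace Ω} {x₀ : Ω → Fin d → ℝ}
    {w : Fin T → Ω → Fin d → ℝ} (t : Fin (T + 1)) (hx₀ : Measurable x₀)
    (hw : ∀ s : Fin T, s.castSucc < t → Measurable (w s)) :
    Measurable fun ω => M.state K (x₀ ω) (fun s => w s ω) t := by
  induction t using Fin.induction with
  | zero => simpa using hx₀
  | succ t ih =>
    simp only [state_succ]
    have h₁ := ih fun s hs => hw s (hs.trans Fin.castSucc_lt_succ)
    have h₂ := hw t Fin.castSucc_lt_succ
    have h₃ : Continuous fun x : Fin d → ℝ => (M.A - M.B * K t) *ᵥ x := by fun_prop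
    exact (h₃.measurable.comp h₁).add h₂

section Law

variable {Ω : Type*} [mΩ : MeasurableSpace Ω] {μ : Measure Ω} {P₀ ν : Measure (Fin d → ℝ)}
  {x₀ : ℕ → Ω → Fin d → ℝ} {w : ℕ → Fin T → Ω → Fin d → ℝ}

lemma hasLaw_state [IsProbabilityMeasure μ] [IsProbabilityMeasure P₀] [IsProbabilityMeasure ν]
    (hx₀m : ∀ k, Measurable (x₀ k)) (hwm : ∀ k s, Measurable (w k s))
    (hx₀ : ∀ ℓ, HasLaw (x₀ ℓ) P₀ μ) (hw : ∀ ℓ t, HasLaw (w ℓ t) ν μ)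
    (hindep : iIndepFun (Sum.elim x₀ fun q : ℕ × Fin T => w q.1 q.2) μ) (k : ℕ)
    (t : Fin (T + 1)) :
    HasLaw (fun ω => M.state K (x₀ k ω) (fun s => w k s ω) t) (M.stateLaw K P₀ ν t) μ := by
  have hm : ∀ i, Measurable (Sum.elim x₀ (fun q : ℕ × Fin T => w q.1 q.2) i) := by
    rintro (k | q)
    exacts [hx₀m k, hwm _ _]
  have h₁ : HasLaw (fun ω s => w k s ω) (Measure.pi fun _ : Fin T => ν) μ := by
    refine iIndepFun.hasLaw_pi (hw k) ?_
    exact hindep.precomp (g := fun s : Fin T => Sum.inr (k, s)) fun s s' h => by simpa using h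
  have h₂ : IndepFun (x₀ k) (fun ω s => w k s ω) μ := by
    refine indepFun_of_measurable_iSup_comap hm hindep (S := {Sum.inl k})
      (S' := Set.range Sum.inr) (by simp) ?_ ?_
    · exact measurable_iSup_comap (Sum.elim x₀ fun q : ℕ × Fin T => w q.1 q.2)
        (i := Sum.inl k) rfl
    · refine @measurable_pi_lambda Ω (Fin T) (fun _ => Fin d → ℝ) (_) _ _ fun s => ?_
      exact measurable_iSup_comap (Sum.elim x₀ fun q : ℕ × Fin T => w q.1 q.2)
        (i := Sum.inr (k, s)) ⟨_, rfl⟩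
  have h₃ := (indepFun_iff_hasLaw_prodMk_prod (hx₀ k) h₁).1 h₂
  have hst : Measurable fun q : (Fin d → ℝ) × (Fin T → Fin d → ℝ) => M.state K q.1 q.2 t :=
    M.measurable_state K t (x₀ := Prod.fst) (w := fun s (q : (Fin d → ℝ) × (Fin T → Fin d → ℝ)) =>
      q.2 s) measurable_fst fun s _ => by fun_prop
  refine ⟨(hst.comp ((hx₀m k).prodMk (measurable_pi_iff.2 (hwm k)))).aemeasurable, ?_⟩
  rw [stateLaw, ← h₃.map_eq, Measure.map_map hst
    ((hx₀m k).prodMk (measurable_pi_iff.2 (hwm k)))]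
  rfl

lemma indepFun_state_noise (hx₀m : ∀ k, Measurable (x₀ k)) (hwm : ∀ k s, Measurable (w k s))
    (hindep : iIndepFun (Sum.elim x₀ fun q : ℕ × Fin T => w q.1 q.2) μ) (k : ℕ) (t : Fin T) :
    IndepFun (fun ω => M.state K (x₀ k ω) (fun s => w k s ω) t.castSucc) (w k t) μ := by
  have hm : ∀ i, Measurable (Sum.elim x₀ (fun q : ℕ × Fin T => w q.1 q.2) i) := by
    rintro (k | q)
    exacts [hx₀m k, hwm _ _]
  refine indepFun_of_measurable_iSup_comap hm hindep (S := {Sum.inr (k, t)}ᶜ)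
      (S' := {Sum.inr (k, t)}) disjoint_compl_left ?_ ?_
  · refine M.measurable_state K _ ?_ fun s hs => ?_
    · exact measurable_iSup_comap (Sum.elim x₀ fun q : ℕ × Fin T => w q.1 q.2)
        (i := Sum.inl k) (by simp)
    · refine measurable_iSup_comap (Sum.elim x₀ fun q : ℕ × Fin T => w q.1 q.2)
        (i := Sum.inr (k, s)) ?_
      have : s ≠ t := fun h => by simp [h] at hs
      simpa using this
  · exact measurable_iSup_comap (Sum.elim x₀ fun q : ℕ × Fin T => w q.1 q.2)
      (i := Sum.inr (k, t)) rfl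

lemma memLp_state (hP₀ : MemLp (fun x => x) 2 P₀) (hν : MemLp (fun x => x) 2 ν)
    (hx₀ : ∀ ℓ, HasLaw (x₀ ℓ) P₀ μ) (hw : ∀ ℓ t, HasLaw (w ℓ t) ν μ) (k : ℕ) (t : Fin (T + 1)) :
    MemLp (fun ω => M.state K (x₀ k ω) (fun s => w k s ω) t) 2 μ := by
  induction t using Fin.induction with
  | zero => simpa using (memLp_of_hasLaw (hx₀ k)).1 hP₀
  | succ t ih =>
    simp only [state_succ]
    exact (memLp_mulVec ih _).add ((memLp_of_hasLaw (hw k t)).1 hν)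

/-- In direction $v$, the cross term between $(A-BK_t)x_t$ and the fresh centred noise has mean zero
by independence. The second moment of $v^\top x_{t+1}$ is thus at least that of $v^\top\omega_t$,
whatever the sampling policy. -/
lemma secondMoment_state_posDef [IsProbabilityMeasure μ] [IsProbabilityMeasure ν]
    (hP₀ : MemLp (fun x => x) 2 P₀)
    (hP₀_pos : (secondMoment (fun x => x) P₀).PosDef) (hν : MemLp (fun x => x) 2 ν)
    (hν_mean : ∫ x, x ∂ν = 0) (hν_pos : (secondMoment (fun x => x) ν).PosDef)
    (hx₀m : ∀ k, Measurable (x₀ k)) (hwm : ∀ k s, Measurable (w k s))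
    (hx₀ : ∀ ℓ, HasLaw (x₀ ℓ) P₀ μ) (hw : ∀ ℓ t, HasLaw (w ℓ t) ν μ)
    (hindep : iIndepFun (Sum.elim x₀ fun q : ℕ × Fin T => w q.1 q.2) μ) (k : ℕ)
    (t : Fin (T + 1)) :
    (secondMoment (fun ω => M.state K (x₀ k ω) (fun s => w k s ω) t) μ).PosDef := by
  induction t using Fin.cases with
  | zero => simpa [← secondMoment_of_hasLaw (hx₀ k)] using hP₀_pos
  | succ t =>
    refine secondMoment_posDef (M.memLp_state K hP₀ hν hx₀ hw k t.succ) fun v hv => ?_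
    simp only [state_succ]
    have hxL := M.memLp_state K hP₀ hν hx₀ hw k t.castSucc
    have hwL := (memLp_of_hasLaw (hw k t)).1 hν
    have ha := memLp_dotProduct (memLp_mulVec hxL (M.A - M.B * K t)) v
    have hb := memLp_dotProduct hwL v
    have hab := (M.indepFun_state_noise K hx₀m hwm hindep k t).comp
      (φ := fun x => v ⬝ᵥ ((M.A - M.B * K t) *ᵥ x)) (ψ := fun y => v ⬝ᵥ y)
      (Continuous.measurable (by fun_prop)) (Continuous.measurable (by fun_prop))
    have hb0 : ∫ ω, v ⬝ᵥ w k t ω ∂μ = 0 := by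
      have hc : ∀ i, ∫ ω, w k t ω i ∂μ = 0 := fun i => by
        refine ((hw k t).integral_comp (f := fun x => x i)
          (Continuous.aestronglyMeasurable (by fun_prop))).trans ?_
        have hi : Integrable (fun x : Fin d → ℝ => x) ν := hν.integrable one_le_two
        have := eval_integral (μ := ν) (f := fun x : Fin d → ℝ => x)
          (fun i => integrable_pi_iff.1 hi i) i
        rw [hν_mean] at this
        exact this.symm
      simp only [dotProduct]
      rw [integral_finsetSum _ fun i _ =>
        ((memLp_pi_iff.1 hwL i).integrable one_le_two).const_mul _]
      simp [integral_const_mul, hc]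
    have hpos := integral_sq_pos_of_posDef hwL
      (by rw [← secondMoment_of_hasLaw (hw k t)]; exact hν_pos) hv
    have hprod := hab.integral_fun_mul_eq_mul_integral ha.1 hb.1
    simp only [Function.comp_apply] at hprod
    rw [hb0, mul_zero] at hprod
    simp only [dotProduct_add]
    have e : ∀ a b : ℝ, (a + b) ^ 2 = a ^ 2 + b ^ 2 + 2 * (a * b) := fun a b => by ring
    simp_rw [e]
    have hi : Integrable (fun ω => (v ⬝ᵥ ((M.A - M.B * K t) *ᵥ
        M.state K (x₀ k ω) (fun s => w k s ω) t.castSucc)) * (v ⬝ᵥ w k t ω)) μ :=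
      ha.integrable_mul hb
    have hs : Integrable (fun ω => (v ⬝ᵥ ((M.A - M.B * K t) *ᵥ
        M.state K (x₀ k ω) (fun s => w k s ω) t.castSucc)) ^ 2 + (v ⬝ᵥ w k t ω) ^ 2) μ :=
      ha.integrable_sq.add hb.integrable_sq
    rw [integral_add hs (hi.const_mul 2),
      integral_add ha.integrable_sq hb.integrable_sq, integral_const_mul, hprod]
    have := integral_nonneg (μ := μ) (f := fun ω => (v ⬝ᵥ ((M.A - M.B * K t) *ᵥ
      M.state K (x₀ k ω) (fun s => w k s ω) t.castSucc)) ^ 2) (fun ω => sq_nonneg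
      (v ⬝ᵥ ((M.A - M.B * K t) *ᵥ M.state K (x₀ k ω) (fun s => w k s ω) t.castSucc)))
    linarith

end Law

end Model

end LQRL

/-! ### Rapid convergence of the iterates, backwards over the stages. -/

namespace LQRL

open Asymptotics
open scoped ENNReal

/-- The information available from the variables `f i` with `stage i < n`. -/
def stageFiltration {Ω ι E : Type*} [MeasurableSpace E] [mΩ : MeasurableSpace Ω] (f : ι → Ω → E)
    (hf : ∀ i, Measurable (f i)) (stage : ι → ℕ) : Filtration ℕ mΩ where
  seq n := ⨆ i ∈ {i | stage i < n}, MeasurableSpace.comap (f i) inferInstance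
  mono' _ _ h := biSup_mono fun _ hi => lt_of_lt_of_le hi h
  le' _ := iSup₂_le fun i _ => (hf i).comap_le

namespace Model

attribute [local instance] Matrix.frobeniusNormedAddCommGroup Matrix.frobeniusNormedSpace

/-- The product σ-algebra on matrices. -/
@[reducible]
def matrixMeasurableSpace (m n : Type*) : MeasurableSpace (Matrix m n ℝ) :=
  inferInstanceAs (MeasurableSpace (m → n → ℝ))

attribute [local instance] matrixMeasurableSpace

lemma matrixBorelSpace (m n : Type*) [Fintype m] [Fintype n] : BorelSpace (Matrix m n ℝ) :=
  inferInstanceAs (BorelSpace (m → n → ℝ))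

lemma matrixSecondCountableTopology (m n : Type*) [Fintype m] [Fintype n] :
    SecondCountableTopology (Matrix m n ℝ) :=
  inferInstanceAs (SecondCountableTopology (m → n → ℝ))

attribute [local instance] matrixBorelSpace matrixSecondCountableTopology

variable {d p T : ℕ} (M : Model d p T)

@[fun_prop]
lemma continuous_policyCost (i : Fin (T + 1)) :
    Continuous fun K : Policy d p T => M.policyCost K i := by
  induction i using Fin.reverseInduction with
  | last => simpa using continuous_const
  | cast t ih =>
    simp only [policyCost_castSucc]
    fun_prop

@[fun_prop]
lemma continuous_gradFactor (t : Fin T) : Continuous fun K : Policy d p T => M.gradFactor K t := by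
  unfold gradFactor
  fun_prop

lemma measurable_iterate {Ω : Type*} [mΩ : MeasurableSpace Ω] (ℱ : Filtration ℕ mΩ) (η : ℕ → ℝ)
    (K₀ : Policy d p T) {x : ℕ → Ω → Fin (T + 1) → Fin d → ℝ}
    (hx : ∀ n i, Measurable[ℱ (n + 1)] fun ω => x n ω i) (n : ℕ) :
    Measurable[ℱ n] fun ω => M.iterate η K₀ (fun k => x k ω) n := by
  induction n with
  | zero => exact measurable_const
  | succ n ih =>
    have ih' := ih.mono (ℱ.mono n.le_succ) le_rfl
    refine @measurable_pi_lambda Ω (Fin T) (fun _ => Matrix (Fin p) (Fin d) ℝ) (_) _ _ fun t => ?_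
    have hc : Continuous fun q : Policy d p T × (Fin d → ℝ) => q.1 t - (2 * η n) •
        (M.gradFactor q.1 t * Matrix.vecMulVec q.2 q.2) := by
      have := (M.continuous_gradFactor t).comp (continuous_fst (X := Policy d p T)
        (Y := Fin d → ℝ))
      simp only [Function.comp_def] at this
      fun_prop
    exact hc.measurable.comp (ih'.prodMk (hx n t.castSucc))

lemma measurable_iterate_vec {Ω : Type*} [mΩ : MeasurableSpace Ω] (η : ℕ → ℝ)
    (K₀ : Policy d p T) {x : ℕ → Ω → Fin (T + 1) → Fin d → ℝ}
    (hx : ∀ n i, Measurable fun ω => x n ω i) (n : ℕ) (t : Fin T) :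
    Measurable fun ω => (M.iterate η K₀ (fun k => x k ω) n t).vec := by
  have h := M.measurable_iterate (⊤ : Filtration ℕ mΩ) η K₀ hx n
  exact measurable_pi_iff.2 fun i => measurable_pi_iff.1 (measurable_pi_iff.1
    (measurable_pi_iff.1 h t) i.2) i.1

variable {M}

/-- One-step contraction in mean of the stage-`t` error, in terms of the error of the cost-to-go
matrix. -/
lemma exists_mean_contraction_step (hM : M.CostPosDef) (t : Fin T) {ρ : Measure (Fin d → ℝ)}
    [IsProbabilityMeasure ρ] (h : MemLp (fun x => x) 2 ρ)
    (hρ : (secondMoment (fun x => x) ρ).PosDef) :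
    ∃ c > 0, ∃ m ≥ 0, ∃ δ > 0, ∀ᶠ η in 𝓝[>] (0 : ℝ), ∀ K : Policy d p T,
      ‖M.policyCost K t.succ - M.riccati t.succ‖ ≤ δ →
      ∫⁻ x, ‖K t - (2 * η) • (M.gradFactor K t * Matrix.vecMulVec x x) - M.optimalPolicy t‖ₑ ∂ρ
        ≤ ENNReal.ofReal ((1 - c * η) * ‖K t - M.optimalPolicy t‖
          + m * η * ‖M.policyCost K t.succ - M.riccati t.succ‖) := by
  obtain ⟨c, hc, m, hm, hcon⟩ := exists_mean_contraction h hρ (optimalHessian_posDef hM t)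
  set b := ‖M.Bᵀ‖ * (‖M.B‖ + ‖M.A - M.B * M.optimalPolicy t‖) with hb
  have hb0 : 0 ≤ b := by positivity
  -- The perturbation is at most $b\|P\|(\|e\|+1)$. The choice of `δ` gives $mb\|P\|\le c/2$, so its
  -- part proportional to $\|e\|$ consumes half of the contraction.
  refine ⟨c / 2, by positivity, m * b, by positivity, c / 2 / (m * b + 1), by positivity, ?_⟩
  filter_upwards [hcon, self_mem_nhdsWithin] with η hη hη0 K hK
  have hη0' : 0 < η := hη0
  set e := K t - M.optimalPolicy t
  set P := M.policyCost K t.succ - M.riccati t.succ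
  have hW : ‖M.Bᵀ * P * (M.B * e - (M.A - M.B * M.optimalPolicy t))‖ ≤ b * ‖P‖ * (‖e‖ + 1) := by
    refine (Matrix.frobenius_norm_mul _ _).trans ?_
    have h₁ := Matrix.frobenius_norm_mul M.Bᵀ P
    have h₂ : ‖M.B * e - (M.A - M.B * M.optimalPolicy t)‖
        ≤ (‖M.B‖ + ‖M.A - M.B * M.optimalPolicy t‖) * (‖e‖ + 1) := by
      refine (norm_sub_le _ _).trans ?_
      have := Matrix.frobenius_norm_mul M.B e
      nlinarith [norm_nonneg M.B, norm_nonneg e, norm_nonneg (M.A - M.B * M.optimalPolicy t)]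
    calc _ ≤ (‖M.Bᵀ‖ * ‖P‖) * ((‖M.B‖ + ‖M.A - M.B * M.optimalPolicy t‖) * (‖e‖ + 1)) := by
          gcongr
      _ = _ := by rw [hb]; ring
  have hstep := hη e (M.Bᵀ * P * (M.B * e - (M.A - M.B * M.optimalPolicy t)))
  rw [← gradFactor_eq hM K t] at hstep
  have hcomm : ∀ x : Fin d → ℝ, K t - (2 * η) • (M.gradFactor K t * Matrix.vecMulVec x x)
      - M.optimalPolicy t = e - (2 * η) • (M.gradFactor K t * Matrix.vecMulVec x x) :=
    fun x => sub_right_comm _ _ _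
  simp_rw [hcomm]
  refine hstep.trans (ENNReal.ofReal_le_ofReal ?_)
  have h₁ : m * b * ‖P‖ ≤ c / 2 := by
    rw [le_div_iff₀ (by positivity)] at hK
    nlinarith [norm_nonneg P]
  have h₂ := mul_le_mul_of_nonneg_left hW (show 0 ≤ m * η by positivity)
  have h₃ := mul_le_mul_of_nonneg_left h₁ (show 0 ≤ η * ‖e‖ by positivity)
  linarith

section Convergence

variable {Ω : Type*} [mΩ : MeasurableSpace Ω] {μ : Measure Ω} [IsProbabilityMeasure μ]

/-- Policy-gradient iterates driven by adapted samples converge faster than any power, stage by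
stage, backwards in time. -/
lemma ae_superpolynomialDecay_iterate (hM : M.CostPosDef) (ℱ : Filtration ℕ mΩ) {η : ℕ → ℝ}
    (hη : Tendsto η atTop (𝓝[>] 0))
    (hη' : Tendsto (fun n : ℕ => ((n : ℝ) + 1) * η n) atTop atTop) (K₀ : Policy d p T)
    {x : ℕ → Ω → Fin (T + 1) → Fin d → ℝ} {ρ : Fin (T + 1) → Measure (Fin d → ℝ)}
    (hx : ∀ n i, Measurable[ℱ (n + 1)] fun ω => x n ω i)
    (hlaw : ∀ n i, HasLaw (fun ω => x n ω i) (ρ i) μ)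
    (hindep : ∀ n i, Indep (ℱ n) (MeasurableSpace.comap (fun ω => x n ω i) inferInstance) μ)
    (hL : ∀ i, MemLp (fun x => x) 2 (ρ i))
    (hpos : ∀ i, (secondMoment (fun x => x) (ρ i)).PosDef) (t : Fin T) :
    ∀ᵐ ω ∂μ, SuperpolynomialDecay atTop (fun n : ℕ => (n : ℝ)) fun n =>
      ‖M.iterate η K₀ (fun k => x k ω) n t - M.optimalPolicy t‖ := by
  -- Induction on the number of remaining stages: all later stages are settled first.
  induction ht : T - t.val using Nat.strong_induction_on generalizing t with
  | _ r ih =>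
  have hpast : ∀ᵐ ω ∂μ, ∀ s : Fin T, t.succ ≤ s.castSucc →
      SuperpolynomialDecay atTop (fun n : ℕ => (n : ℝ)) fun n =>
        ‖M.iterate η K₀ (fun k => x k ω) n s - M.optimalPolicy s‖ := by
    simp only [ae_all_iff]
    intro s hs
    have hs' : t.val < s.val := by simpa [Fin.le_def] using hs
    exact ih (T - s.val) (by omega) s rfl
  have : IsProbabilityMeasure (ρ t.castSucc) :=
    (hlaw 0 t.castSucc).isProbabilityMeasure_iff.1 inferInstance
  obtain ⟨c, hc, m, hm, δ, hδ, hstep⟩ :=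
    exists_mean_contraction_step hM t (hL t.castSucc) (hpos t.castSucc)
  have hK := M.measurable_iterate ℱ η K₀ hx
  have heK : Measurable fun K : Policy d p T => ‖K t - M.optimalPolicy t‖ :=
    Continuous.measurable (by fun_prop)
  have hDK : Measurable fun K : Policy d p T => ‖M.policyCost K t.succ - M.riccati t.succ‖ :=
    Continuous.measurable (by fun_prop)
  refine ae_superpolynomialDecay_of_mean_contraction ℱ
    (e := fun n ω => ‖M.iterate η K₀ (fun k => x k ω) n t - M.optimalPolicy t‖)
    (D := fun n ω => ‖M.policyCost (M.iterate η K₀ (fun k => x k ω) n) t.succ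
      - M.riccati t.succ‖) (fun _ _ => norm_nonneg _) (fun n => heK.comp (hK n))
    (fun n => hDK.comp (hK n)) (hη.mono_right nhdsWithin_le_nhds) hη' hc hm hδ ?_ ?_
  · filter_upwards [hη.eventually hstep, hη.eventually self_mem_nhdsWithin,
      ((hη.mono_right nhdsWithin_le_nhds).const_mul c).eventually_lt_const
        (show c * 0 < 1 by simp)] with n hn hn0 hn1 A hA hAδ
    have hn0' : 0 < η n := hn0
    have hc' : Continuous fun q : Policy d p T × (Fin d → ℝ) =>
        ‖q.1 t - (2 * η n) • (M.gradFactor q.1 t * Matrix.vecMulVec q.2 q.2)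
          - M.optimalPolicy t‖ₑ := by
      have := (M.continuous_gradFactor t).comp (continuous_fst (X := Policy d p T)
        (Y := Fin d → ℝ))
      simp only [Function.comp_def] at this
      fun_prop
    -- The current policy is frozen and the fresh, independent state is integrated out, which brings
    -- in the one-step contraction.
    have hfub := setLIntegral_eq_of_indep (ℱ.le n) (hK n)
      ((hx n t.castSucc).mono (ℱ.le _) le_rfl) (hindep n t.castSucc) hc'.measurable hA
    rw [(hlaw n t.castSucc).map_eq] at hfub
    simp only [iterate, ofReal_norm]
    refine hfub.trans_le ?_
    have hA' := ℱ.le n _ hA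
    refine (setLIntegral_mono' hA' fun ω hω => hn _ (hAδ ω hω)).trans ?_
    have e₁ : ∀ ω, ENNReal.ofReal ((1 - c * η n) *
          ‖M.iterate η K₀ (fun k => x k ω) n t - M.optimalPolicy t‖
          + m * η n * ‖M.policyCost (M.iterate η K₀ (fun k => x k ω) n) t.succ
            - M.riccati t.succ‖)
        = ENNReal.ofReal (1 - c * η n) *
          ‖M.iterate η K₀ (fun k => x k ω) n t - M.optimalPolicy t‖ₑ
          + ENNReal.ofReal (m * η n) *
            ‖M.policyCost (M.iterate η K₀ (fun k => x k ω) n) t.succ - M.riccati t.succ‖ₑ := by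
      intro ω
      have h₁ : 0 ≤ 1 - c * η n := by linarith
      have h₂ : 0 ≤ m * η n := by positivity
      rw [ENNReal.ofReal_add (by positivity) (by positivity), ENNReal.ofReal_mul h₁,
        ENNReal.ofReal_mul h₂, ofReal_norm, ofReal_norm]
    simp_rw [e₁]
    have hm₁ : Measurable fun ω =>
        ‖M.iterate η K₀ (fun k => x k ω) n t - M.optimalPolicy t‖ₑ := by
      simpa only [ofReal_norm, Function.comp_def] using
        ((heK.comp (hK n)).mono (ℱ.le n) le_rfl).ennreal_ofReal
    have hm₂ : Measurable fun ω =>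
        ‖M.policyCost (M.iterate η K₀ (fun k => x k ω) n) t.succ - M.riccati t.succ‖ₑ := by
      simpa only [ofReal_norm, Function.comp_def] using
        ((hDK.comp (hK n)).mono (ℱ.le n) le_rfl).ennreal_ofReal
    rw [lintegral_add_left (hm₁.const_mul _), lintegral_const_mul _ hm₁,
      lintegral_const_mul _ hm₂]
  -- The cost-to-go error at stage $t+1$ involves later stages only, so it inherits their rapid
  -- decay.
  · filter_upwards [hpast] with ω hω
    rw [← policyCost_optimalPolicy hM]
    exact superpolynomialDecay_norm fun a b => RapidlyTendsto.policyCost M t.succ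
      (fun s hs => rapidlyTendsto_entry (hω s hs)) a b

end Convergence

end Model

end LQRL

/-! ### Step sizes, measurable samples and the degenerate limit law. -/

namespace LQRL

open Asymptotics
open scoped ENNReal

open scoped MatrixOrder in
lemma multivariateGaussian_zero_right {ι : Type*} [Fintype ι] [DecidableEq ι]
    (m : EuclideanSpace ℝ ι) : multivariateGaussian m (0 : Matrix ι ι ℝ) = Measure.dirac m := by
  rw [multivariateGaussian, CFC.sqrt_zero]
  simp

/-- Only the law of the limit matters, so the constant limit $0$ can be exchanged for the identity
under the degenerate Gaussian. -/
lemma TendstoInDistribution.of_map_eq {ι E Ω' Ω'' : Type*} {Ω : ι → Type*}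
    {m : ∀ i, MeasurableSpace (Ω i)} {μ : ∀ i, Measure (Ω i)} [∀ i, IsProbabilityMeasure (μ i)]
    {m' : MeasurableSpace Ω'} {μ' : Measure Ω'} [IsProbabilityMeasure μ']
    {m'' : MeasurableSpace Ω''} {μ'' : Measure Ω''} [IsProbabilityMeasure μ'']
    [TopologicalSpace E] [MeasurableSpace E] [OpensMeasurableSpace E] {X : ∀ i, Ω i → E}
    {l : Filter ι} {Z : Ω' → E} {W : Ω'' → E} (h : TendstoInDistribution X l Z μ μ')
    (hW : AEMeasurable W μ'') (hZW : μ'.map Z = μ''.map W) :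
    TendstoInDistribution X l W μ μ'' where
  forall_aemeasurable := h.forall_aemeasurable
  aemeasurable_limit := hW
  tendsto := by
    have e : (⟨μ'.map Z, Measure.isProbabilityMeasure_map h.aemeasurable_limit⟩ :
        ProbabilityMeasure E) = ⟨μ''.map W, Measure.isProbabilityMeasure_map hW⟩ :=
      Subtype.ext hZW
    exact e ▸ h.tendsto

lemma tendsto_stepSize {η : ℕ → ℝ} {C α : ℝ} (hC : 0 < C) (hα : 0 < α)
    (hη : ∀ ℓ : ℕ, 1 ≤ ℓ → η ℓ = C * (ℓ : ℝ) ^ (-α)) : Tendsto η atTop (𝓝[>] 0) := by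
  refine tendsto_nhdsWithin_iff.2 ⟨?_, ?_⟩
  · have h := ((tendsto_rpow_neg_atTop hα).comp tendsto_natCast_atTop_atTop).const_mul C
    rw [mul_zero] at h
    refine h.congr' ?_
    filter_upwards [eventually_ge_atTop 1] with n hn
    exact (hη n hn).symm
  · filter_upwards [eventually_ge_atTop 1] with n hn
    have hn' : (0 : ℝ) < n := by exact_mod_cast hn
    rw [hη n hn]
    exact mul_pos hC (Real.rpow_pos_of_pos hn' _)

/-- Here $(n+1)\eta_n\ge Cn^{1-\alpha}$, and $\alpha<1$. This growth is what makes the contraction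
beat every power. -/
lemma tendsto_mul_stepSize {η : ℕ → ℝ} {C α : ℝ} (hC : 0 < C) (hα : α < 1)
    (hη : ∀ ℓ : ℕ, 1 ≤ ℓ → η ℓ = C * (ℓ : ℝ) ^ (-α)) :
    Tendsto (fun n : ℕ => ((n : ℝ) + 1) * η n) atTop atTop := by
  have h := ((tendsto_rpow_atTop (sub_pos.2 hα)).comp
    tendsto_natCast_atTop_atTop).const_mul_atTop hC
  refine tendsto_atTop_mono' _ ?_ h
  filter_upwards [eventually_ge_atTop 1] with n hn
  have hn' : (0 : ℝ) < n := by exact_mod_cast hn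
  have h1 := Real.rpow_pos_of_pos hn' (-α)
  rw [hη n hn, Function.comp_apply, sub_eq_add_neg, Real.rpow_add hn', Real.rpow_one]
  nlinarith [mul_pos hC h1]

namespace Model

attribute [local instance] Matrix.frobeniusNormedAddCommGroup Matrix.frobeniusNormedSpace

variable {d p T : ℕ} {M : Model d p T} {Ω : Type*} [mΩ : MeasurableSpace Ω] {μ : Measure Ω}
  [IsProbabilityMeasure μ] {P₀ ν : Measure (Fin d → ℝ)} [IsProbabilityMeasure P₀]
  [IsProbabilityMeasure ν] {x₀ : ℕ → Ω → Fin d → ℝ} {w : ℕ → Fin T → Ω → Fin d → ℝ}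

lemma ae_superpolynomialDecay_iterate_of_measurable (hM : M.CostPosDef)
    (hP₀ : MemLp (fun x => x) 2 P₀) (hP₀_pos : (secondMoment (fun x => x) P₀).PosDef)
    (hν : MemLp (fun x => x) 2 ν) (hν_mean : ∫ x, x ∂ν = 0)
    (hν_pos : (secondMoment (fun x => x) ν).PosDef) {η : ℕ → ℝ} (hη : Tendsto η atTop (𝓝[>] 0))
    (hη' : Tendsto (fun n : ℕ => ((n : ℝ) + 1) * η n) atTop atTop) (Kb K₀ : Policy d p T)
    (hx₀m : ∀ k, Measurable (x₀ k)) (hwm : ∀ k s, Measurable (w k s))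
    (hx₀ : ∀ ℓ, HasLaw (x₀ ℓ) P₀ μ) (hw : ∀ ℓ t, HasLaw (w ℓ t) ν μ)
    (hindep : iIndepFun (Sum.elim x₀ fun q : ℕ × Fin T => w q.1 q.2) μ) (t : Fin T) :
    ∀ᵐ ω ∂μ, SuperpolynomialDecay atTop (fun n : ℕ => (n : ℝ)) fun n =>
      ‖M.iterate η K₀ (fun k => M.state Kb (x₀ k ω) (fun s => w k s ω)) n t
        - M.optimalPolicy t‖ := by
  have hm : ∀ i, Measurable (Sum.elim x₀ (fun q : ℕ × Fin T => w q.1 q.2) i) := by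
    rintro (k | q)
    exacts [hx₀m k, hwm _ _]
  have hlaw := M.hasLaw_state Kb hx₀m hwm hx₀ hw hindep
  have hstage : ∀ (S : Set (ℕ ⊕ ℕ × Fin T)) (n : ℕ) (i : Fin (T + 1)),
      Sum.inl n ∈ S → (∀ s, Sum.inr (n, s) ∈ S) →
      Measurable[⨆ i ∈ S, MeasurableSpace.comap
        (Sum.elim x₀ (fun q : ℕ × Fin T => w q.1 q.2) i) inferInstance]
        fun ω => M.state Kb (x₀ n ω) (fun s => w n s ω) i := fun S n i h₁ h₂ =>
    M.measurable_state Kb i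
      (measurable_iSup_comap (Sum.elim x₀ fun q : ℕ × Fin T => w q.1 q.2) h₁)
      fun s _ => measurable_iSup_comap (Sum.elim x₀ fun q : ℕ × Fin T => w q.1 q.2) (h₂ s)
  let stage : ℕ ⊕ ℕ × Fin T → ℕ := Sum.elim id Prod.fst
  refine ae_superpolynomialDecay_iterate hM (stageFiltration _ hm stage) hη hη' K₀
    (ρ := M.stateLaw Kb P₀ ν) (fun n i => hstage _ n i ?_ ?_) hlaw (fun n i => ?_) (fun i => ?_)
    (fun i => ?_) t
  · exact Nat.lt_succ_self n
  · exact fun s => Nat.lt_succ_self n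
  -- Time `n` of the filtration sees trajectories with index strictly below `n`, so trajectory `n`
  -- uses a disjoint set of inputs.
  · have h := indep_iSup_of_disjoint (fun i => (hm i).comap_le) hindep
      (S := {i | stage i < n}) (T := {i | stage i = n})
      (Set.disjoint_left.2 fun i hi hi' => hi.ne hi')
    exact indep_of_indep_of_le_right h (hstage {i | stage i = n} n i rfl fun s => rfl).comap_le
  · exact (memLp_of_hasLaw (hlaw 0 i)).2 (M.memLp_state Kb hP₀ hν hx₀ hw 0 i)
  · rw [secondMoment_of_hasLaw (hlaw 0 i)]
    exact M.secondMoment_state_posDef Kb hP₀ hP₀_pos hν hν_mean hν_pos hx₀m hwm hx₀ hw hindep 0 i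

lemma tendsto_average_vec {e : ℕ → Matrix (Fin p) (Fin d) ℝ} {K : Matrix (Fin p) (Fin d) ℝ}
    (h : SuperpolynomialDecay atTop (fun n : ℕ => (n : ℝ)) fun n => ‖e n - K‖) :
    Tendsto (fun n : ℕ => (WithLp.toLp 2 ((1 / √(n : ℝ)) • ∑ ℓ ∈ Finset.Icc 1 n,
      ((e ℓ).vec - K.vec)) : EuclideanSpace ℝ (Fin d × Fin p))) atTop (𝓝 0) := by
  have h' := tendsto_average_zero (e := fun n => (e n).vec - K.vec) (h.trans_abs_le fun n => by
    rw [abs_norm, abs_norm, pi_norm_le_iff_of_nonneg (norm_nonneg _)]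
    exact fun i => norm_entry_le (e n - K) i.2 i.1)
  simpa [Function.comp_def] using ((PiLp.continuous_toLp 2 _).tendsto 0).comp h'

end Model

end LQRL

/-! ### The main theorem. -/

theorem theorem1 {d p T : ℕ} (M : LQRL.Model d p T)
    (hcost : M.CostPosDef) (hstab : M.Stabilizable)
    -- law of the initial state and law of the noise
    (P₀ ν : Measure (Fin d → ℝ)) [IsProbabilityMeasure P₀] [IsProbabilityMeasure ν]
    (hP₀ : MemLp (fun x => x) 2 P₀)
    (hP₀_pos : (LQRL.secondMoment (fun x => x) P₀).PosDef)
    (hν : MemLp (fun x => x) 2 ν) (hν_mean : ∫ x, x ∂ν = 0)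
    (hν_pos : (LQRL.secondMoment (fun x => x) ν).PosDef)
    -- step sizes
    (η : ℕ → ℝ) (C α : ℝ) (hC : 0 < C) (hα : α ∈ Set.Ico (1 / 2 : ℝ) 1)
    (hη : ∀ ℓ : ℕ, 1 ≤ ℓ → η ℓ = C * (ℓ : ℝ) ^ (-α))
    -- policy that generates the sampled states, and initial policy of the iteration
    (Kb K₀ : LQRL.Policy d p T)
    -- iteration `ℓ` uses a fresh initial state `x₀ ℓ` and fresh noises `w ℓ 0, …, w ℓ (T-1)`
    {Ω : Type*} [MeasurableSpace Ω] (μ : Measure Ω) [IsProbabilityMeasure μ]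
    (x₀ : ℕ → Ω → Fin d → ℝ) (w : ℕ → Fin T → Ω → Fin d → ℝ)
    (hx₀ : ∀ ℓ, HasLaw (x₀ ℓ) P₀ μ) (hw : ∀ ℓ t, HasLaw (w ℓ t) ν μ)
    (hindep : iIndepFun (Sum.elim x₀ fun q : ℕ × Fin T => w q.1 q.2) μ)
    (t : Fin T) :
    let Pt : Measure (Fin d → ℝ) := M.stateLaw Kb P₀ ν t.castSucc
    let K : ℕ → Ω → LQRL.Policy d p T := fun ℓ ω =>
      M.iterate η K₀ (fun k => M.state Kb (x₀ k ω) (fun s => w k s ω)) ℓ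
    MemLp (fun x => x) 2 Pt ∧ (M.G Pt t).PosDef ∧ MemLp (M.optScore t) 2 Pt ∧
    TendstoInDistribution
      (fun (n : ℕ) (ω : Ω) => (WithLp.toLp 2
        ((1 / √(n : ℝ)) • ∑ ℓ ∈ Finset.Icc 1 n,
          ((K ℓ ω t).vec - (M.optimalPolicy t).vec)) : EuclideanSpace ℝ (Fin d × Fin p)))
      atTop id (fun _ => μ)
      (multivariateGaussian 0 ((M.G Pt t)⁻¹ * M.S Pt t * (M.G Pt t)⁻¹)) := by
  intro Pt K
  -- The inputs are only almost everywhere measurable. Measurable versions keep the laws and the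
  -- independence, and countability makes all trajectories agree outside one null set.
  let x₀' : ℕ → Ω → Fin d → ℝ := fun k => (hx₀ k).aemeasurable.mk
  let w' : ℕ → Fin T → Ω → Fin d → ℝ := fun k s => (hw k s).aemeasurable.mk
  have hx₀m : ∀ k, Measurable (x₀' k) := fun k => (hx₀ k).aemeasurable.measurable_mk
  have hwm : ∀ k s, Measurable (w' k s) := fun k s => (hw k s).aemeasurable.measurable_mk
  have hx₀e : ∀ k, x₀ k =ᵐ[μ] x₀' k := fun k => (hx₀ k).aemeasurable.ae_eq_mk
  have hwe : ∀ k s, w k s =ᵐ[μ] w' k s := fun k s => (hw k s).aemeasurable.ae_eq_mk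
  have hx₀' : ∀ k, HasLaw (x₀' k) P₀ μ := fun k => (hx₀ k).congr (hx₀e k).symm
  have hw' : ∀ k s, HasLaw (w' k s) ν μ := fun k s => (hw k s).congr (hwe k s).symm
  have hindep' : iIndepFun (Sum.elim x₀' fun q : ℕ × Fin T => w' q.1 q.2) μ := by
    refine hindep.congr ?_
    rintro (k | q)
    exacts [hx₀e k, hwe _ _]
  have hsample : ∀ᵐ ω ∂μ, (fun k => M.state Kb (x₀ k ω) (fun s => w k s ω))
      = fun k => M.state Kb (x₀' k ω) (fun s => w' k s ω) := by
    filter_upwards [ae_all_iff.2 hx₀e, ae_all_iff.2 fun k => ae_all_iff.2 (hwe k)] with ω h₁ h₂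
    funext k
    rw [h₁ k]
    congr 1
    exact funext fun s => h₂ k s
  have hlaw := M.hasLaw_state Kb hx₀m hwm hx₀' hw' hindep' 0 t.castSucc
  have hPt : MemLp (fun x => x) 2 Pt :=
    (LQRL.memLp_of_hasLaw hlaw).2 (M.memLp_state Kb hP₀ hν hx₀' hw' 0 t.castSucc)
  have hPt_pos : (LQRL.secondMoment (fun x => x) Pt).PosDef := by
    rw [LQRL.secondMoment_of_hasLaw hlaw]
    exact M.secondMoment_state_posDef Kb hP₀ hP₀_pos hν hν_mean hν_pos hx₀m hwm hx₀' hw'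
      hindep' 0 t.castSucc
  have hconv := LQRL.Model.ae_superpolynomialDecay_iterate_of_measurable hcost hP₀ hP₀_pos hν
    hν_mean hν_pos (LQRL.tendsto_stepSize hC (by linarith [hα.1]) hη)
    (LQRL.tendsto_mul_stepSize hC hα.2 hη) Kb K₀ hx₀m hwm hx₀' hw' hindep' t
  have hscore := LQRL.Model.optScore_eq_zero hcost t
  have hS : M.S Pt t = 0 := by
    ext i j
    simp [LQRL.Model.S, LQRL.secondMoment, hscore]
  refine ⟨hPt, hPt_pos.kronecker (LQRL.Model.optimalHessian_posDef hcost t),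
    hscore ▸ MemLp.zero, ?_⟩
  refine LQRL.TendstoInDistribution.of_map_eq (Z := fun _ : Ω => 0) (μ' := μ)
    (tendstoInDistribution_of_ae_tendsto (fun n => ?_) aemeasurable_const ?_) aemeasurable_id ?_
  · have hK : ∀ ℓ, AEMeasurable (fun ω => (K ℓ ω t).vec) μ := fun ℓ => by
      refine ⟨fun ω => (M.iterate η K₀
        (fun k => M.state Kb (x₀' k ω) (fun s => w' k s ω)) ℓ t).vec, ?_, ?_⟩
      · exact M.measurable_iterate_vec η K₀
          (fun k i => M.measurable_state Kb i (hx₀m k) fun s _ => hwm k s) ℓ t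
      · filter_upwards [hsample] with ω hω
        simp only [K, hω]
    refine (PiLp.continuous_toLp 2 _).measurable.comp_aemeasurable ?_
    exact (Finset.aemeasurable_fun_sum _ fun ℓ _ => (hK ℓ).sub_const _).const_smul
      (1 / √(n : ℝ))
  · filter_upwards [hsample, hconv] with ω hω hωc
    simp only [K, hω]
    exact LQRL.Model.tendsto_average_vec hωc
  · rw [hS, Matrix.mul_zero, Matrix.zero_mul, LQRL.multivariateGaussian_zero_right,
      Measure.map_id, Measure.map_const, measure_univ, one_smul]
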